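/- Let $n\ge 1$, $R>0$, $\gamma>1$, $\mu>0$, $2\mu+n\lambda>0$, $\mathcal K\ge 0$, let $m$ be an integer with $m>[n/2]+2$, and put $c_\nu=R/(\gamma-1)$. Consider the Cauchy problem in $\mathbb R^n$ for the full compressible Navier–Stokes equations $$\partial_t\rho+\operatorname{div}(\rho u)=0,$$ $$\partial_t(\rho u)+\operatorname{div}(\rho u\otimes u)+\nabla p=\operatorname{div}\mathcal T,$$ $$\partial_t\big(\tfrac12\rho|u|^2+\rho e\big)+\operatorname{div}\big((\tfrac12\rho|u|^2+\rho e+p)u\big)=\operatorname{div}(u\mathcal T)+\mathcal K\Delta\theta,$$ with stress tensor $\mathcal T=\mu(\nabla u+(\nabla u)^t)+\lambda(\operatorname{div}u)I$ and state equations $p=R\rho\theta=\exp(s/c_\nu)\rho^\gamma$, $e=c_\nu\theta$, where $\rho\ge 0$ is the density, $u$ the velocity, $s$ the entropy and $\theta$ the temperature. Let the initial data $(\rho,u,s)|_{t=0}=(\rho_0,u_0,s_0)$ be such that $\rho_0$ has compact support and positive mass, $\int_{\mathbb R^n}\rho_0\,dx>0$. Then every smooth solution blows up in finite time: there is $T^*>0$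 (fixed once the parameters and the initial data are fixed) such that $T<T^*$ whenever there is, on $[0,T]$ with $T>0$, a classical solution $(\rho,u,s)\in C^1([0,T];H^m(\mathbb R^n))$, with temperature $\theta$, of this Cauchy problem which, if $\mathcal K\neq 0$, satisfies $$|\nabla\theta(x,t)|=o\big(|x|^{-(n-1)}\big)\quad\text{as }|x|\to\infty,\ \text{for every }t\in(0,T].$$ Here a classical solution is one for which $\rho,u,s$ are $C^1$ on $[0,T]\times\mathbb R^n$, $u(\cdot,t)$ is $C^2$ for every $t\in[0,T]$, and, if $\mathcal K\ne0$, $\theta(\cdot,t)$ is $C^2$ for every $t\in(0,T]$. -/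

import Mathlib

open MeasureTheory Set Filter Topology Asymptotics
open scoped SchwartzMap InnerProductSpace

noncomputable section

namespace CNS

/-- The space `ℝⁿ` with its Euclidean norm. -/
abbrev Space (n : ℕ) : Type := EuclideanSpace ℝ (Fin n)

/-- The partial derivative `∂ⱼ f (x)`. -/
def pderiv {n : ℕ} (j : Fin n) (f : Space n → ℝ) (x : Space n) : ℝ :=
  fderiv ℝ f x (EuclideanSpace.single j 1)

/-- The divergence `div v (x) = ∑ⱼ ∂ⱼ vⱼ (x)`. -/
def divergence {n : ℕ} (v : Space n → Space n) (x : Space n) : ℝ :=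
  ∑ j, pderiv j (fun y => v y j) x

/-- The entry `𝒯ᵢⱼ = μ (∂ⱼ uᵢ + ∂ᵢ uⱼ) + λ (div u) δᵢⱼ` of the stress tensor of the velocity
field `v`. -/
def stress {n : ℕ} (μ lam : ℝ) (v : Space n → Space n) (i j : Fin n) (x : Space n) : ℝ :=
  μ * (pderiv j (fun y => v y i) x + pderiv i (fun y => v y j) x)
    + if i = j then lam * divergence v x else 0

/-- The specific heat at constant volume, `c_ν = R / (γ - 1)`. -/
def specificHeat (R γ : ℝ) : ℝ := R / (γ - 1)

/-- The pressure `p = R ρ θ`. -/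
def pressure {n : ℕ} (R : ℝ) (ρ θ : ℝ → Space n → ℝ) (t : ℝ) (x : Space n) : ℝ :=
  R * ρ t x * θ t x

/-- The total energy density `½ ρ |u|² + ρ e`, where `e = c_ν θ` is the internal energy. -/
def energyDensity {n : ℕ} (R γ : ℝ) (ρ : ℝ → Space n → ℝ) (u : ℝ → Space n → Space n)
    (θ : ℝ → Space n → ℝ) (t : ℝ) (x : Space n) : ℝ :=
  1 / 2 * ρ t x * ‖u t x‖ ^ 2 + ρ t x * (specificHeat R γ * θ t x)

/-- `(ρ, u, s)`, with temperature `θ`, is a classical solution on `[0, T] × ℝⁿ` of the full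
compressible Navier-Stokes equations of a polytropic gas. In regions of vacuum the state equation
leaves `θ` free. When the heat conduction `K` vanishes, no regularity of `θ` itself is required:
only `ρ θ` enters the equations, and the state equation expresses it through `ρ` and `s`. -/
structure IsClassicalSolution {n : ℕ} (R γ μ lam K T : ℝ) (ρ : ℝ → Space n → ℝ)
    (u : ℝ → Space n → Space n) (s θ : ℝ → Space n → ℝ) : Prop where
  contDiff_density :
    ContDiffOn ℝ 1 (fun q : ℝ × Space n => ρ q.1 q.2) (Icc 0 T ×ˢ univ)
  contDiff_velocity :
    ContDiffOn ℝ 1 (fun q : ℝ × Space n => u q.1 q.2) (Icc 0 T ×ˢ univ)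
  contDiff_entropy :
    ContDiffOn ℝ 1 (fun q : ℝ × Space n => s q.1 q.2) (Icc 0 T ×ˢ univ)
  contDiff_two_velocity : ∀ t ∈ Icc 0 T, ContDiff ℝ 2 (u t)
  contDiff_two_temperature : K ≠ 0 → ∀ t ∈ Ioc 0 T, ContDiff ℝ 2 (θ t)
  density_nonneg : ∀ t ∈ Icc 0 T, ∀ x, 0 ≤ ρ t x
  /-- The state equation `R ρ θ = p = exp (s / c_ν) ρ ^ γ`. -/
  state : ∀ t ∈ Icc 0 T, ∀ x,
    pressure R ρ θ t x = Real.exp (s t x / specificHeat R γ) * ρ t x ^ γ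
  /-- `∂ₜ ρ + div (ρ u) = 0`. -/
  mass : ∀ t ∈ Ioo 0 T, ∀ x,
    deriv (fun τ => ρ τ x) t + divergence (fun y => ρ t y • u t y) x = 0
  /-- `∂ₜ (ρ u) + div (ρ u ⊗ u) + ∇ p = div 𝒯`, by components. -/
  momentum : ∀ t ∈ Ioo 0 T, ∀ x, ∀ i : Fin n,
    deriv (fun τ => ρ τ x * u τ x i) t
        + ∑ j, pderiv j (fun y => ρ t y * u t y i * u t y j) x
        + pderiv i (pressure R ρ θ t) x
      = ∑ j, pderiv j (stress μ lam (u t) i j) x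
  /-- `∂ₜ (½ ρ |u|² + ρ e) + div ((½ ρ |u|² + ρ e + p) u) = div (u 𝒯) + K Δ θ`. -/
  energy : ∀ t ∈ Ioo 0 T, ∀ x,
    deriv (fun τ => energyDensity R γ ρ u θ τ x) t
        + divergence (fun y => (energyDensity R γ ρ u θ t y + pressure R ρ θ t y) • u t y) x
      = ∑ j, pderiv j (fun y => ∑ i, u t y i * stress μ lam (u t) i j y) x
        + K * Laplacian.laplacian (θ t) x

/-- `f ∈ C¹([0, T]; Hᵐ(ℝⁿ))`. The Bessel potential operator of order `m` is an isomorphism from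
`Hᵐ` onto `L²`; here `v` is the curve `f` with values in `L²`, and `g` is its image under this
operator, which has to be a `C¹` curve in `L²`. -/
def IsC1Sobolev {n : ℕ} (m : ℕ) (T : ℝ) (f : ℝ → Space n → ℝ) : Prop :=
  ∃ v g : ℝ → Lp ℂ 2 (volume : Measure (Space n)),
    (∀ t ∈ Icc 0 T, v t =ᵐ[volume] fun x => (f t x : ℂ)) ∧
    (∀ t ∈ Icc 0 T, TemperedDistribution.besselPotential (Space n) ℂ (m : ℝ)
      (v t : 𝓢'(Space n, ℂ)) = (g t : 𝓢'(Space n, ℂ))) ∧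
    ContDiffOn ℝ 1 g (Icc 0 T)

/-- The temperature gradient satisfies `|∇θ| = o(1 / |x|^(n-1))` as `|x| → ∞`, for every
`t ∈ (0, T]`. -/
def TemperatureGradientDecay {n : ℕ} (T : ℝ) (θ : ℝ → Space n → ℝ) : Prop :=
  ∀ t ∈ Ioc 0 T,
    (fun x => gradient (θ t) x) =o[cocompact (Space n)] fun x => 1 / ‖x‖ ^ (n - 1)

end CNS

end

/-! The gas cannot leave the ball of radius `R₀` that contains it initially, yet a virial identity
forces its radial momentum to grow at least linearly. Mass and energy bound that momentum in a fixed
ball, so the life span is bounded.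

Confinement rests on the equations in vacuum. There `ρ`, the pressure and the energy density attain
their minimum zero, so their first derivatives vanish, the viscous force is zero, and dissipation
plus `K Δθ` is zero. For `K = 0` the dissipation is zero at once. For `K > 0` one integrates `Δθ`:
the decay of `∇θ` excludes flux through infinity, the gas contributes a nonpositive amount since
heat flows out of the set of positive temperature, and the vacuum contributes minus the dissipation
over `K`. Hence the dissipation vanishes in an exterior vacuum (`dissipation_eq_zero_of_norm_gt`).
Since `2μ + nλ > 0`, so does the symmetric gradient; the velocity is then affine along rays,
constant by boundedness and zero by square integrability (`eq_zero_of_symm_gradient_eq_zero`). A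
continuous induction along flow lines turns this into a support that does not grow
(`density_eq_zero_of_norm_gt`).

With `u = 0` outside the ball, mass and energy `E` are conserved, and `∫ ρ x·u` has derivative `∫
(ρ|u|² + n p) ≥ min(2, γ - 1) E`, while its modulus is at most `R₀ (M/2 + E)` with `M` the mass
(`mul_energy_le`). The state equation expresses `E` through the initial data, and it is positive
because the mass is.

The Sobolev hypothesis serves only to make the velocity bounded and square integrable. -/

namespace CNS

/-! ### Uniform bounds from the Sobolev embedding -/

open FourierTransform TemperedDistribution in
/-- The quantitative form of the main estimate of the Sobolev embedding theorem. -/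
theorem exists_fourier_norm_le (n : ℕ) (s : ℝ) (hn : n < 2 * s) :
    ∃ C : ℝ, 0 ≤ C ∧ ∀ v g : Lp ℂ 2 (volume : Measure (Space n)),
      besselPotential (Space n) ℂ s (v : 𝓢'(Space n, ℂ)) = (g : 𝓢'(Space n, ℂ)) →
      ∃ w : Lp ℂ 1 (volume : Measure (Space n)),
        𝓕 (v : 𝓢'(Space n, ℂ)) = (w : 𝓢'(Space n, ℂ)) ∧ ‖w‖ ≤ C * ‖g‖ := by
  have hs : (Module.finrank ℝ (Space n) : ℝ) < 2 * s := by
    rwa [finrank_euclideanSpace_fin]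
  have h2 : MemLp (fun x : Space n ↦ (1 + ‖x‖ ^ 2) ^ (-s / 2)) 2 := by
    have hg : (fun x : Space n ↦ (1 + ‖x‖ ^ 2) ^ (-s / 2)).HasTemperateGrowth := by
      fun_prop
    rw [memLp_two_iff_integrable_sq hg.1.continuous.aestronglyMeasurable]
    apply (integrable_rpow_neg_one_add_norm_sq hs).congr
    filter_upwards with x
    rw [← Real.rpow_mul_natCast (by positivity)]
    congr 1
    push_cast
    ring
  have h3 : MemLp (fun x : Space n ↦ Complex.ofReal ((1 + ‖x‖ ^ 2) ^ (-s / 2) : ℝ)) 2 :=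
    h2.ofReal
  refine ⟨‖h3.toLp‖, norm_nonneg _, fun v g hvg => ?_⟩
  have hu : smulLeftCLM ℂ (fun x : Space n ↦ ((1 + ‖x‖ ^ 2) ^ (s / 2) : ℝ))
      (𝓕 (v : 𝓢'(Space n, ℂ))) = ((𝓕 g : Lp ℂ 2 (volume : Measure (Space n))) :
        𝓢'(Space n, ℂ)) := by
    apply_fun 𝓕 at hvg
    rw [fourier_besselPotential_eq_smulLeftCLM_fourier_apply] at hvg
    rw [hvg, Lp.fourier_toTemperedDistribution_eq]
  -- The weight `(1 + ‖ξ‖²)^(-s/2)` is in `L²` because `n < 2s`, so Hölder and Plancherel put its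
  -- product with `𝓕 g` in `L¹`.
  refine ⟨h3.toLp • 𝓕 g, ?_, ?_⟩
  · rw [Lp.toTemperedDistribution_smul_eq]
    · rw [← hu, smulLeftCLM_smulLeftCLM_apply (by fun_prop) (by fun_prop)]
      convert! (smulLeftCLM_const 1 (𝓕 (v : 𝓢'(Space n, ℂ)))).symm using 1
      · simp
      · congr
        ext x
        rw [Pi.mul_apply]
        norm_cast
        rw [← Real.rpow_add (by positivity)]
        ring_nf
        simp
    · fun_prop
  · grw [Lp.norm_smul_le, Lp.norm_fourier_eq]

open FourierTransform TemperedDistribution in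
theorem norm_schwartz_fourierInv_le {n : ℕ} (φ : 𝓢(Space n, ℂ)) (x : Space n) :
    ‖(𝓕⁻ φ) x‖ ≤ ∫ y, ‖φ y‖ := by
  rw [SchwartzMap.fourierInv_coe, Real.fourierInv_eq']
  refine (norm_integral_le_integral_norm _).trans (le_of_eq ?_)
  refine integral_congr_ae (Eventually.of_forall fun y => ?_)
  simp only [norm_smul]
  rw [Complex.norm_exp]
  simp

-- Pairing `v` with `φ` equals pairing `𝓕 v`, an `L¹` function, with `𝓕⁻ φ`, whose modulus is at
-- most the `L¹` norm of `φ`. This is a sup bound in dual form, so no continuous representative of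
-- `v` has to be chosen.
open FourierTransform TemperedDistribution in
theorem exists_norm_integral_le (n m : ℕ) (hm : n < 2 * m) :
    ∃ C : ℝ, 0 ≤ C ∧ ∀ v g : Lp ℂ 2 (volume : Measure (Space n)),
      besselPotential (Space n) ℂ (m : ℝ) (v : 𝓢'(Space n, ℂ)) = (g : 𝓢'(Space n, ℂ)) →
      ∀ φ : 𝓢(Space n, ℂ), ‖∫ x, φ x * v x‖ ≤ C * ‖g‖ * ∫ x, ‖φ x‖ := by
  obtain ⟨C, hC, h⟩ := exists_fourier_norm_le n m (by exact_mod_cast hm)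
  refine ⟨C, hC, fun v g hvg φ => ?_⟩
  obtain ⟨w, hw, hwC⟩ := h v g hvg
  have h1 : (𝓕 (v : 𝓢'(Space n, ℂ))) (𝓕⁻ φ) = ∫ x, φ x * v x := by
    rw [TemperedDistribution.fourier_apply, FourierTransform.fourier_fourierInv_eq]
    simp [Lp.toTemperedDistribution_apply]
  rw [← h1, hw, Lp.toTemperedDistribution_apply]
  have hI : Integrable w := memLp_one_iff_integrable.1 (Lp.memLp w)
  calc ‖∫ x, (𝓕⁻ φ) x • w x‖ ≤ ∫ x, (∫ y, ‖φ y‖) * ‖w x‖ := by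
        refine norm_integral_le_of_norm_le (hI.norm.const_mul _) (Eventually.of_forall fun x => ?_)
        rw [norm_smul]
        gcongr
        exact norm_schwartz_fourierInv_le φ x
    _ = (∫ y, ‖φ y‖) * ‖w‖ := by
        rw [integral_const_mul, L1.norm_eq_integral_norm]
    _ ≤ _ := by
        rw [mul_comm]
        gcongr

/-- A continuous function that is bounded by `A` in the dual of `L¹` is bounded by `A`. -/
theorem abs_le_of_integral_le {n : ℕ} {f : Space n → ℝ} (hf : Continuous f) {A : ℝ}
    (h : ∀ φ : 𝓢(Space n, ℂ), ‖∫ x, φ x * (f x : ℂ)‖ ≤ A * ∫ x, ‖φ x‖) (x : Space n) :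
    |f x| ≤ A := by
  by_contra! hlt
  obtain ⟨σ, hσ, hσx⟩ : ∃ σ : ℝ, (σ = 1 ∨ σ = -1) ∧ A < σ * f x := by
    rcases abs_cases (f x) with ⟨h1, -⟩ | ⟨h1, -⟩
    · exact ⟨1, Or.inl rfl, by linarith⟩
    · exact ⟨-1, Or.inr rfl, by linarith⟩
  have hev : ∀ᶠ y in 𝓝 x, A < σ * f y :=
    (continuous_const.mul hf).continuousAt.eventually (lt_mem_nhds hσx)
  obtain ⟨δ, hδ, hball⟩ := Metric.eventually_nhds_iff_ball.1 hev
  -- A bump supported where `σ f > A` violates the dual bound when used as a test function.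
  let b : ContDiffBump x := ⟨δ / 4, δ / 2, by positivity, by linarith⟩
  have hbs : ContDiff ℝ (⊤ : ℕ∞) (fun y => ((b y : ℝ) : ℂ)) :=
    Complex.ofRealCLM.contDiff.comp b.contDiff
  have hbc : HasCompactSupport (fun y => ((b y : ℝ) : ℂ)) :=
    b.hasCompactSupport.comp_left (g := fun r : ℝ => (r : ℂ)) rfl
  have key := h (hbc.toSchwartzMap hbs)
  have e1 : ∫ y, (hbc.toSchwartzMap hbs) y * (f y : ℂ) = ((∫ y, b y * f y : ℝ) : ℂ) := by
    rw [← integral_complex_ofReal]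
    refine integral_congr_ae (Eventually.of_forall fun y => ?_)
    simp
  have e2 : ∫ y, ‖(hbc.toSchwartzMap hbs) y‖ = ∫ y, b y := by
    refine integral_congr_ae (Eventually.of_forall fun y => ?_)
    simp [abs_of_nonneg b.nonneg]
  rw [e1, e2, Complex.norm_real, Real.norm_eq_abs] at key
  have hbI : Integrable (fun y => b y) := b.integrable
  have hbfI : Integrable (fun y => b y * f y) :=
    (b.continuous.mul hf).integrable_of_hasCompactSupport b.hasCompactSupport.mul_right
  have hpos : 0 < ∫ y, b y * (σ * f y - A) := by
    have hc : Continuous fun y => b y * (σ * f y - A) := by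
      have := b.continuous
      fun_prop
    refine hc.integral_pos_of_hasCompactSupport_nonneg_nonzero (x := x)
      b.hasCompactSupport.mul_right (fun y => ?_) ?_
    · by_cases hy : y ∈ Metric.ball x δ
      · exact mul_nonneg b.nonneg (by linarith [hball y hy])
      · have : b y = 0 := by
          apply b.zero_of_le_dist
          simp only [Metric.mem_ball, not_lt] at hy
          show δ / 2 ≤ _
          linarith
        simp [this]
    · have : b x = 1 := b.one_of_mem_closedBall (by simp [b]; positivity)
      rw [this]
      linarith
  have e3 : ∫ y, b y * (σ * f y - A) = σ * (∫ y, b y * f y) - A * ∫ y, b y := by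
    rw [← integral_const_mul, ← integral_const_mul, ← integral_sub (hbfI.const_mul _)
      (hbI.const_mul _)]
    congr 1
    ext y
    ring
  have : σ * (∫ y, b y * f y) ≤ |∫ y, b y * f y| := by
    rcases hσ with rfl | rfl
    · simpa using le_abs_self _
    · simpa using neg_le_abs _
  linarith

/-- The Sobolev embedding: curves in `Hᵐ` with `m > n / 2` are uniformly bounded. -/
theorem IsC1Sobolev.exists_bound {n m : ℕ} (hm : n < 2 * m) {T : ℝ} {f : ℝ → Space n → ℝ}
    (h : IsC1Sobolev m T f) (hf : ∀ t ∈ Icc 0 T, Continuous (f t)) :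
    ∃ A : ℝ, ∀ t ∈ Icc 0 T, ∀ x, |f t x| ≤ A := by
  obtain ⟨v, g, hv, hb, hg⟩ := h
  obtain ⟨C, hC, hdual⟩ := exists_norm_integral_le n m hm
  obtain ⟨B, hB⟩ := isCompact_Icc.exists_bound_of_continuousOn hg.continuousOn
  refine ⟨C * B, fun t ht x => ?_⟩
  have : |f t x| ≤ C * ‖g t‖ := by
    refine abs_le_of_integral_le (hf t ht) (fun φ => ?_) x
    convert hdual (v t) (g t) (hb t ht) φ using 2
    refine integral_congr_ae ?_
    filter_upwards [hv t ht] with y hy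
    rw [hy]
  exact this.trans (by gcongr; exact hB t ht)

theorem IsC1Sobolev.memLp {n m : ℕ} {T : ℝ} {f : ℝ → Space n → ℝ}
    (h : IsC1Sobolev m T f) {t : ℝ} (ht : t ∈ Icc 0 T) : MemLp (f t) 2 := by
  obtain ⟨v, g, hv, -, -⟩ := h
  have := ((Lp.memLp (v t)).ae_eq (hv t ht)).re
  simpa using this

end CNS

/-! ### Partial derivatives and time slices -/

namespace CNS

section Calculus

variable {n : ℕ}

theorem fderiv_apply_eq_sum_pderiv (f : Space n → ℝ) (x v : Space n) :
    fderiv ℝ f x v = ∑ j, v j * pderiv j f x := by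
  conv_lhs => rw [← (EuclideanSpace.basisFun (Fin n) ℝ).sum_repr v]
  simp [pderiv]

theorem differentiableAt_coord {v : Space n → Space n} {x : Space n}
    (hv : DifferentiableAt ℝ v x) (i : Fin n) : DifferentiableAt ℝ (fun y => v y i) x :=
  (EuclideanSpace.proj (𝕜 := ℝ) i).differentiableAt.comp x hv

theorem contDiff_coord {k : WithTop ℕ∞} {v : Space n → Space n} (hv : ContDiff ℝ k v) (i : Fin n) :
    ContDiff ℝ k (fun y => v y i) :=
  (EuclideanSpace.proj (𝕜 := ℝ) i).contDiff.comp hv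

theorem pderiv_coord (v : Space n → Space n) {x : Space n} (hv : DifferentiableAt ℝ v x)
    (i j : Fin n) : pderiv j (fun y => v y i) x = fderiv ℝ v x (EuclideanSpace.single j 1) i := by
  have := ((EuclideanSpace.proj (𝕜 := ℝ) i).hasFDerivAt.comp x hv.hasFDerivAt).fderiv
  rw [pderiv]
  erw [this]
  rfl

theorem pderiv_mul {f g : Space n → ℝ} {x : Space n} (hf : DifferentiableAt ℝ f x)
    (hg : DifferentiableAt ℝ g x) (j : Fin n) :
    pderiv j (fun y => f y * g y) x = f x * pderiv j g x + g x * pderiv j f x := by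
  simp [pderiv, fderiv_fun_mul hf hg]

theorem pderiv_add {f g : Space n → ℝ} {x : Space n} (hf : DifferentiableAt ℝ f x)
    (hg : DifferentiableAt ℝ g x) (j : Fin n) :
    pderiv j (fun y => f y + g y) x = pderiv j f x + pderiv j g x := by
  simp [pderiv, fderiv_fun_add hf hg]

theorem pderiv_sum {ι : Type*} {s : Finset ι} {f : ι → Space n → ℝ} {x : Space n}
    (hf : ∀ i ∈ s, DifferentiableAt ℝ (f i) x) (j : Fin n) :
    pderiv j (fun y => ∑ i ∈ s, f i y) x = ∑ i ∈ s, pderiv j (f i) x := by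
  simp [pderiv, fderiv_fun_sum hf]

theorem pderiv_congr {f g : Space n → ℝ} {x : Space n} (h : f =ᶠ[𝓝 x] g) (j : Fin n) :
    pderiv j f x = pderiv j g x := by
  rw [pderiv, pderiv, h.fderiv_eq]

theorem pderiv_eq_zero_of_eventually {f : Space n → ℝ} {x : Space n} (h : ∀ᶠ y in 𝓝 x, f y = 0)
    (j : Fin n) : pderiv j f x = 0 := by
  rw [pderiv_congr (g := fun _ => 0) h]
  simp [pderiv]

theorem pderiv_coordinate (i j : Fin n) (x : Space n) :
    pderiv j (fun y : Space n => y i) x = if i = j then 1 else 0 := by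
  have := pderiv_coord (n := n) id (x := x) differentiableAt_id i j
  simp only [id] at this
  rw [this]
  simp

theorem contDiff_pderiv {k l : WithTop ℕ∞} {f : Space n → ℝ} (hf : ContDiff ℝ k f)
    (h : l + 1 ≤ k) (j : Fin n) : ContDiff ℝ l (pderiv j f) :=
  (hf.fderiv_right h).clm_apply contDiff_const

theorem divergence_smul {f : Space n → ℝ} {v : Space n → Space n} {x : Space n}
    (hf : DifferentiableAt ℝ f x) (hv : DifferentiableAt ℝ v x) :
    divergence (fun y => f y • v y) x = f x * divergence v x + ∑ j, v x j * pderiv j f x := by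
  simp only [divergence, Finset.mul_sum, ← Finset.sum_add_distrib]
  refine Finset.sum_congr rfl fun j _ => ?_
  simp only [PiLp.smul_apply, smul_eq_mul]
  exact pderiv_mul hf (differentiableAt_coord hv j) j

end Calculus

section Slices

variable {n : ℕ} {E : Type*} [NormedAddCommGroup E] [NormedSpace ℝ E] {T : ℝ}
  {f : ℝ → Space n → E}

theorem contDiff_slice (hf : ContDiffOn ℝ 1 (fun q : ℝ × Space n => f q.1 q.2) (Icc 0 T ×ˢ univ))
    {t : ℝ} (ht : t ∈ Icc 0 T) : ContDiff ℝ 1 (f t) := by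
  rw [← contDiffOn_univ]
  exact hf.comp (contDiff_prodMk_right t).contDiffOn fun x _ => ⟨ht, mem_univ _⟩

theorem contDiffAt_uncurry
    (hf : ContDiffOn ℝ 1 (fun q : ℝ × Space n => f q.1 q.2) (Icc 0 T ×ˢ univ))
    {t : ℝ} (ht : t ∈ Ioo 0 T) (x : Space n) :
    ContDiffAt ℝ 1 (fun q : ℝ × Space n => f q.1 q.2) (t, x) :=
  hf.contDiffAt (prod_mem_nhds (Icc_mem_nhds ht.1 ht.2) univ_mem)

theorem hasFDerivAt_uncurry
    (hf : ContDiffOn ℝ 1 (fun q : ℝ × Space n => f q.1 q.2) (Icc 0 T ×ˢ univ))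
    {t : ℝ} (ht : t ∈ Ioo 0 T) (x : Space n) :
    HasFDerivAt (fun q : ℝ × Space n => f q.1 q.2)
      (fderiv ℝ (fun q : ℝ × Space n => f q.1 q.2) (t, x)) (t, x) :=
  ((contDiffAt_uncurry hf ht x).differentiableAt one_ne_zero).hasFDerivAt

theorem hasDerivAt_slice
    (hf : ContDiffOn ℝ 1 (fun q : ℝ × Space n => f q.1 q.2) (Icc 0 T ×ˢ univ))
    {t : ℝ} (ht : t ∈ Ioo 0 T) (x : Space n) :
    HasDerivAt (fun τ => f τ x) (fderiv ℝ (fun q : ℝ × Space n => f q.1 q.2) (t, x) (1, 0)) t :=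
  (hasFDerivAt_uncurry hf ht x).comp_hasDerivAt (f := fun τ : ℝ => (τ, x)) t
    ((hasDerivAt_id t).prodMk (hasDerivAt_const t x))

theorem fderiv_slice
    (hf : ContDiffOn ℝ 1 (fun q : ℝ × Space n => f q.1 q.2) (Icc 0 T ×ˢ univ))
    {t : ℝ} (ht : t ∈ Ioo 0 T) (x v : Space n) :
    fderiv ℝ (f t) x v = fderiv ℝ (fun q : ℝ × Space n => f q.1 q.2) (t, x) (0, v) := by
  have h := (hasFDerivAt_uncurry hf ht x).comp (f := fun y : Space n => (t, y)) x
    ((hasFDerivAt_const t x).prodMk (hasFDerivAt_id x))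
  have h2 : fderiv ℝ (f t) x = _ := h.fderiv
  rw [h2]
  simp

omit [NormedSpace ℝ E] in
theorem continuousOn_slice_time
    (hf : ContinuousOn (fun q : ℝ × Space n => f q.1 q.2) (Icc 0 T ×ˢ univ)) (x : Space n) :
    ContinuousOn (fun τ => f τ x) (Icc 0 T) :=
  hf.comp (by fun_prop : Continuous fun τ : ℝ => (τ, x)).continuousOn fun _ ht => ⟨ht, mem_univ _⟩

/-- The set is compact and convex, and the function is `C¹` up to the end times, so the constant is
uniform on the closed time interval. -/
theorem exists_lipschitz_closedBall
    (hf : ContDiffOn ℝ 1 (fun q : ℝ × Space n => f q.1 q.2) (Icc 0 T ×ˢ univ))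
    (x : Space n) (r : ℝ) : ∃ L : NNReal,
    LipschitzOnWith L (fun q : ℝ × Space n => f q.1 q.2) (Icc 0 T ×ˢ Metric.closedBall x r) :=
  (hf.mono (prod_mono_right (subset_univ _))).exists_lipschitzOnWith one_ne_zero
    ((convex_Icc 0 T).prod (convex_closedBall x r))
    (isCompact_Icc.prod (isCompact_closedBall x r))

end Slices

/-! ### Flow lines and confinement of the gas -/

/-- Flow lines of a bounded `C¹` velocity field exist on the whole time interval. -/
theorem exists_flowLine {n : ℕ} {T U : ℝ} {u : ℝ → Space n → Space n}
    (hu : ContDiffOn ℝ 1 (fun q : ℝ × Space n => u q.1 q.2) (Icc 0 T ×ˢ univ))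
    (hU : ∀ t ∈ Icc 0 T, ∀ x, ‖u t x‖ ≤ U) {t₁ : ℝ} (ht₁ : t₁ ∈ Icc 0 T) (x₁ : Space n) :
    ∃ X : ℝ → Space n, X t₁ = x₁ ∧
      ∀ t ∈ Icc 0 T, HasDerivWithinAt X (u t (X t)) (Icc 0 T) t := by
  have hT : 0 ≤ T := ht₁.1.trans ht₁.2
  have hU0 : 0 ≤ U := (norm_nonneg _).trans (hU t₁ ht₁ x₁)
  -- A curve of speed at most `U` stays in the ball of radius `U * T`, so one application of
  -- Picard–Lindelöf covers the whole interval without continuation.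
  obtain ⟨L, hL⟩ := exists_lipschitz_closedBall hu x₁ (U * T)
  have hP : IsPicardLindelof u (tmin := 0) (tmax := T) ⟨t₁, ht₁⟩ x₁
      ⟨U * T, by positivity⟩ 0 ⟨U, hU0⟩ L := by
    refine ⟨fun t ht => ?_, fun x _ => continuousOn_slice_time hu.continuousOn x,
      fun t ht x _ => hU t ht x, ?_⟩
    · refine LipschitzOnWith.of_dist_le_mul fun x hx y hy => ?_
      simpa [Prod.dist_eq] using
        hL.dist_le_mul (t, x) ⟨ht, hx⟩ (t, y) ⟨ht, hy⟩
    · simp only [NNReal.coe_zero, sub_zero]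
      exact mul_le_mul_of_nonneg_left (max_le (by linarith [ht₁.1]) (by linarith [ht₁.2])) hU0
  obtain ⟨X, hX, hX'⟩ := hP.exists_eq_forall_mem_Icc_hasDerivWithinAt₀
  exact ⟨X, hX, hX'⟩

/-- A function with `|y'| ≤ A |y|` that vanishes initially vanishes identically. -/
theorem eq_zero_of_abs_deriv_le {a b A : ℝ} {y y' : ℝ → ℝ} (hc : ContinuousOn y (Icc a b))
    (hy : ∀ t ∈ Ioo a b, HasDerivAt y (y' t) t) (hA : ∀ t ∈ Ioo a b, |y' t| ≤ A * |y t|)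
    (ha : y a = 0) (hab : a ≤ b) : y b = 0 := by
  -- Grönwall for the square of `y`, which is differentiable where `|y|` may not be.
  have hanti : AntitoneOn (fun t => y t ^ 2 * Real.exp (-(2 * A) * t)) (Icc a b) := by
    refine antitoneOn_of_hasDerivWithinAt_nonpos (convex_Icc a b)
      (f' := fun t => (2 * y t * y' t - 2 * A * y t ^ 2) * Real.exp (-(2 * A) * t)) ?_ ?_ ?_
    · exact (hc.pow 2).mul (by fun_prop)
    · intro t ht
      rw [interior_Icc] at ht
      have h1 := ((hy t ht).pow 2).mul
        (((hasDerivAt_id t).const_mul (-(2 * A))).exp)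
      refine HasDerivAt.hasDerivWithinAt ?_
      refine h1.congr_deriv ?_
      simp only [id, Pi.pow_apply]
      push_cast
      ring
    · intro t ht
      rw [interior_Icc] at ht
      refine mul_nonpos_of_nonpos_of_nonneg ?_ (Real.exp_pos _).le
      have h1 := hA t ht
      have h2 : y t * y' t ≤ |y t| * |y' t| := by rw [← abs_mul]; exact le_abs_self _
      have h3 : |y t| * |y' t| ≤ |y t| * (A * |y t|) := by gcongr
      have h4 : |y t| * (A * |y t|) = A * y t ^ 2 := by rw [← sq_abs]; ring
      nlinarith
  have h1 := hanti (left_mem_Icc.2 hab) (right_mem_Icc.2 hab) hab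
  simp only [ha] at h1
  have h2 : 0 < Real.exp (-(2 * A) * b) := Real.exp_pos _
  have h3 : y b ^ 2 ≤ 0 := by
    by_contra! h
    have h4 := mul_pos h h2
    rw [zero_pow two_ne_zero, zero_mul] at h1
    exact absurd h1 (not_le.2 h4)
  exact pow_eq_zero_iff (two_ne_zero) |>.1 (le_antisymm h3 (sq_nonneg _))

/-- By the continuity equation vacuum is transported along flow lines. -/
theorem density_eq_zero_of_flowLine {n : ℕ} {T : ℝ} {ρ : ℝ → Space n → ℝ}
    {u : ℝ → Space n → Space n}
    (hρ : ContDiffOn ℝ 1 (fun q : ℝ × Space n => ρ q.1 q.2) (Icc 0 T ×ˢ univ))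
    (hu : ContDiffOn ℝ 1 (fun q : ℝ × Space n => u q.1 q.2) (Icc 0 T ×ˢ univ))
    (mass : ∀ t ∈ Ioo 0 T, ∀ x,
      deriv (fun τ => ρ τ x) t + divergence (fun y => ρ t y • u t y) x = 0)
    {X : ℝ → Space n} (hX : ∀ t ∈ Icc 0 T, HasDerivWithinAt X (u t (X t)) (Icc 0 T) t)
    {a b : ℝ} (ha : 0 ≤ a) (hab : a ≤ b) (hb : b ≤ T) (h0 : ρ a (X a) = 0) : ρ b (X b) = 0 := by
  have hXc : ContinuousOn X (Icc 0 T) := fun t ht => (hX t ht).continuousWithinAt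
  obtain ⟨r, hr⟩ := (isCompact_Icc.image_of_continuousOn hXc).isBounded.subset_closedBall 0
  -- The extra `1` makes this ball a neighbourhood of every `X t`, so that `L` bounds the derivative
  -- there.
  obtain ⟨L, hL⟩ := exists_lipschitz_closedBall hu (0 : Space n) (r + 1)
  have hsub : Icc a b ⊆ Icc 0 T := Icc_subset_Icc ha hb
  have hsubo : Ioo a b ⊆ Ioo 0 T := Ioo_subset_Ioo ha hb
  refine eq_zero_of_abs_deriv_le (A := n * L) (y := fun t => ρ t (X t))
    (y' := fun t => -(ρ t (X t) * divergence (u t) (X t)))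
    (hρ.continuousOn.comp (continuousOn_id.prodMk (hXc.mono hsub))
      fun t ht => ⟨hsub ht, mem_univ _⟩) (fun t ht => ?_) (fun t ht => ?_) h0 hab
  · have ht' := hsubo ht
    have hXt := (hX t (Ioo_subset_Icc_self ht')).hasDerivAt (Icc_mem_nhds ht'.1 ht'.2)
    have h1 := (hasFDerivAt_uncurry hρ ht' (X t)).comp_hasDerivAt (f := fun τ => (τ, X τ)) t
      ((hasDerivAt_id t).prodMk hXt)
    convert! h1 using 1
    have h2 := mass t ht' (X t)
    have hd := (contDiff_slice hρ (Ioo_subset_Icc_self ht')).differentiable one_ne_zero (X t)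
    have hd' := (contDiff_slice hu (Ioo_subset_Icc_self ht')).differentiable one_ne_zero (X t)
    rw [divergence_smul hd hd', ← fderiv_apply_eq_sum_pderiv, fderiv_slice hρ ht',
      (hasDerivAt_slice hρ ht' (X t)).deriv] at h2
    have h3 : ((1 : ℝ), u t (X t)) = (1, 0) + (0, u t (X t)) := by simp
    rw [h3, map_add]
    linarith
  · have ht' := hsubo ht
    have hmem : X t ∈ Metric.closedBall (0 : Space n) r :=
      hr ⟨t, Ioo_subset_Icc_self ht', rfl⟩
    rw [abs_neg, abs_mul, mul_comm]
    refine mul_le_mul_of_nonneg_right ?_ (abs_nonneg _)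
    have hd' := (contDiff_slice hu (Ioo_subset_Icc_self ht')).differentiable one_ne_zero (X t)
    have hfd : ‖fderiv ℝ (u t) (X t)‖ ≤ L := by
      have hnhds : Metric.closedBall (0 : Space n) (r + 1) ∈ 𝓝 (X t) := by
        refine mem_of_superset (Metric.ball_mem_nhds (X t) one_pos) fun y hy => ?_
        simp only [Metric.mem_closedBall, Metric.mem_ball] at *
        linarith [dist_triangle y (X t) 0]
      refine norm_fderiv_le_of_lipschitzOn ℝ hnhds (C := L) ?_
      refine LipschitzOnWith.of_dist_le_mul fun x hx y hy => ?_
      have ht2 := Ioo_subset_Icc_self ht'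
      simpa [Prod.dist_eq] using hL.dist_le_mul (t, x) ⟨ht2, hx⟩ (t, y) ⟨ht2, hy⟩
    calc |divergence (u t) (X t)| ≤ ∑ j : Fin n, (L : ℝ) := by
          refine (Finset.abs_sum_le_sum_abs _ _).trans (Finset.sum_le_sum fun j _ => ?_)
          rw [pderiv_coord _ hd']
          refine (PiLp.norm_apply_le (p := 2) (fderiv ℝ (u t) (X t) (EuclideanSpace.single j 1)) j).trans ?_
          refine (ContinuousLinearMap.le_opNorm _ _).trans ?_
          simpa using hfd
      _ = n * L := by simp

/-- If the velocity vanishes in exterior domains of vacuum, the gas stays in the ball that contains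
it initially. -/
theorem density_eq_zero_of_norm_gt {n : ℕ} {T U R₀ : ℝ} {ρ : ℝ → Space n → ℝ}
    {u : ℝ → Space n → Space n}
    (hρ : ContDiffOn ℝ 1 (fun q : ℝ × Space n => ρ q.1 q.2) (Icc 0 T ×ˢ univ))
    (hu : ContDiffOn ℝ 1 (fun q : ℝ × Space n => u q.1 q.2) (Icc 0 T ×ˢ univ))
    (mass : ∀ t ∈ Ioo 0 T, ∀ x,
      deriv (fun τ => ρ τ x) t + divergence (fun y => ρ t y • u t y) x = 0)
    (hU : ∀ t ∈ Icc 0 T, ∀ x, ‖u t x‖ ≤ U) (hR₀ : 0 ≤ R₀)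
    (h0 : ∀ x, R₀ < ‖x‖ → ρ 0 x = 0)
    (hvac : ∀ t ∈ Ioo 0 T, ∀ r, 0 ≤ r → (∀ x, r < ‖x‖ → ρ t x = 0) → ∀ x, r < ‖x‖ → u t x = 0) :
    ∀ t ∈ Icc 0 T, ∀ x, R₀ < ‖x‖ → ρ t x = 0 := by
  rcases lt_or_ge T 0 with hT | hT
  · intro t ht
    linarith [ht.1, ht.2]
  have hU0 : 0 ≤ U := (norm_nonneg _).trans (hU 0 ⟨le_rfl, hT⟩ 0)
  have hXderiv : ∀ {X : ℝ → Space n} {a b : ℝ}, 0 ≤ a → b ≤ T →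
      (∀ t ∈ Icc 0 T, HasDerivWithinAt X (u t (X t)) (Icc 0 T) t) → ContinuousOn X (Icc a b) ∧
      ∀ t ∈ Ico a b, HasDerivWithinAt X (u t (X t)) (Ici t) t := by
    intro X a b ha hb hX
    refine ⟨fun t ht => ((hX t ⟨ha.trans ht.1, ht.2.trans hb⟩).continuousWithinAt).mono
      (Icc_subset_Icc ha hb), fun t ht => ?_⟩
    have h1 := hX t ⟨ha.trans ht.1, ht.2.le.trans hb⟩
    refine (h1.mono (Icc_subset_Icc_left (ha.trans ht.1))).mono_of_mem_nhdsWithin ?_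
    exact Icc_mem_nhdsGE (ht.2.trans_le hb)
  -- finite speed of propagation
  have hfinite : ∀ t ∈ Icc 0 T, ∀ x, R₀ + U * t < ‖x‖ → ρ t x = 0 := by
    intro t ht x hx
    obtain ⟨X, hX, hX'⟩ := exists_flowLine hu hU ht x
    rw [← hX]
    refine density_eq_zero_of_flowLine hρ hu mass hX' le_rfl ht.1 ht.2 (h0 _ ?_)
    obtain ⟨hc, hd⟩ := hXderiv le_rfl ht.2 hX'
    have := norm_image_sub_le_of_norm_deriv_right_le_segment (C := U) hc hd
      (fun s hs => hU s ⟨hs.1, hs.2.le.trans ht.2⟩ _) t (right_mem_Icc.2 ht.1)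
    rw [hX, sub_zero] at this
    linarith [norm_sub_norm_le x (X 0)]
  -- the support does not grow with any positive speed
  have hind : ∀ t₀ ∈ Ioo 0 T, ∀ ε > 0, ∀ t ∈ Icc t₀ T, ∀ x,
      R₀ + U * t₀ + ε * (t - t₀) < ‖x‖ → ρ t x = 0 := by
    intro t₀ ht₀ ε hε
    have hsub : Icc t₀ T ⊆ Icc 0 T := Icc_subset_Icc_left ht₀.1.le
    -- Continuous induction in time: `S` is closed in `[t₀, T]`, contains `t₀` by finite speed, and
    -- reaches beyond each of its points. Starting at `t₀ > 0` matters, since `hvac` is available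
    -- only at interior times.
    set S : Set ℝ := {t | ∀ x, R₀ + U * t₀ + ε * (t - t₀) < ‖x‖ → ρ t x = 0} with hS
    have hclosed : IsClosed (S ∩ Icc t₀ T) := by
      refine isClosed_of_closure_subset fun t ht => ?_
      have htI : t ∈ Icc t₀ T := closure_minimal inter_subset_right isClosed_Icc ht
      refine ⟨fun x hx => ?_, htI⟩
      obtain ⟨τ, hτ, hτt⟩ := mem_closure_iff_seq_limit.1 ht
      have hρx : Tendsto (fun k => ρ (τ k) x) atTop (𝓝 (ρ t x)) := by
        have hw := (continuousOn_slice_time hρ.continuousOn x) t (hsub htI)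
        exact hw.tendsto.comp (tendsto_nhdsWithin_iff.2 ⟨hτt,
          Eventually.of_forall fun k => hsub (hτ k).2⟩)
      have hev : ∀ᶠ k in atTop, R₀ + U * t₀ + ε * (τ k - t₀) < ‖x‖ := by
        have : Tendsto (fun k => R₀ + U * t₀ + ε * (τ k - t₀)) atTop
            (𝓝 (R₀ + U * t₀ + ε * (t - t₀))) :=
          ((hτt.sub_const t₀).const_mul ε).const_add _
        exact this.eventually_lt_const hx
      refine tendsto_nhds_unique hρx (tendsto_const_nhds.congr' ?_)
      filter_upwards [hev] with k hk
      exact ((hτ k).1 x hk).symm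
    refine hclosed.Icc_subset_of_forall_exists_gt (fun x hx => ?_) fun t ht b hb => ?_
    · exact hfinite t₀ (Ioo_subset_Icc_self ht₀) x (by simpa using hx)
    · obtain ⟨htS, htI⟩ := ht
      have htI0 : t ∈ Icc 0 T := hsub (Ico_subset_Icc_self htI)
      set r := R₀ + U * t₀ + ε * (t - t₀) with hr
      have hr0 : 0 ≤ r := by
        have := mul_nonneg hU0 ht₀.1.le
        have := mul_nonneg hε.le (sub_nonneg.2 htI.1)
        linarith
      have hut : ∀ x, r < ‖x‖ → u t x = 0 :=
        hvac t ⟨ht₀.1.trans_le htI.1, htI.2⟩ r hr0 htS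
      obtain ⟨L, hL⟩ := exists_lipschitz_closedBall hu (0 : Space n) (r + 1)
      -- The first two bounds keep `t + h` below `b` and `T`. The third gives `ε h ≤ 1`, keeping the
      -- barrier below in the ball of radius `r + 1`; the fourth gives `L h < ε / 2`, so `u` stays
      -- slower than the barrier.
      set h := min (min (b - t) (T - t)) (min (1 / (ε + 1)) (ε / (L + 1) / 2)) with hh
      have hL0 : (0 : ℝ) < L + 1 := by positivity
      have hhpos : 0 < h := by
        have h1 : 0 < b - t := sub_pos.2 hb
        have h2 : 0 < T - t := sub_pos.2 htI.2
        have h3 : 0 < 1 / (ε + 1) := by positivity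
        have h4 : 0 < ε / (L + 1) / 2 := by positivity
        exact lt_min (lt_min h1 h2) (lt_min h3 h4)
      have hhb : h ≤ b - t := (min_le_left _ _).trans (min_le_left _ _)
      have hhT : h ≤ T - t := (min_le_left _ _).trans (min_le_right _ _)
      have hhε : ε * h ≤ 1 := by
        have : h ≤ 1 / (ε + 1) := (min_le_right _ _).trans (min_le_left _ _)
        rw [le_div_iff₀ (by positivity)] at this
        nlinarith
      have hhL : L * h < ε / 2 := by
        have h1 : h ≤ ε / (L + 1) / 2 := (min_le_right _ _).trans (min_le_right _ _)
        rw [div_div, le_div_iff₀ (by positivity)] at h1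
        linarith
      refine ⟨t + h, fun x hx => ?_, by linarith, by linarith⟩
      obtain ⟨X, hX, hX'⟩ := exists_flowLine hu hU
        (t₁ := t + h) ⟨by linarith [htI0.1], by linarith⟩ x
      rw [← hX]
      refine density_eq_zero_of_flowLine hρ hu mass hX' htI0.1 (by linarith) (by linarith)
        (htS _ ?_)
      by_contra! hle
      obtain ⟨hc, hd⟩ := hXderiv (a := t) (b := t + h) htI0.1 (by linarith) hX'
      -- The flow line cannot cross a barrier moving at speed `ε / 2`: at contact `‖X τ‖ > r`, so `u
      -- t` vanishes at that point and `u τ` is at most `L (τ - t)`. The offset `ε / 2 * h` makes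
      -- contact occur strictly outside radius `r`, and the barrier ends exactly at `r + ε h`.
      have := image_norm_le_of_norm_deriv_right_lt_deriv_boundary
        (B := fun τ => r + ε / 2 * h + ε / 2 * (τ - t)) (B' := fun _ => ε / 2) hc hd
        (by have := mul_pos hε hhpos; simp only [sub_self, mul_zero]; linarith)
        (fun τ => by
          simpa using (((hasDerivAt_id τ).sub_const t).const_mul (ε / 2)).const_add (r + ε / 2 * h))
        (fun τ hτ hτX => ?_) (right_mem_Icc.2 (by linarith))
      · rw [hX, add_sub_cancel_left] at this
        have e : R₀ + U * t₀ + ε * (t + h - t₀) = r + ε * h := by rw [hr]; ring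
        linarith
      · have hτh : ε * (τ - t) ≤ ε * h := by gcongr; linarith [hτ.2]
        have hτ0 : 0 ≤ ε * (τ - t) := mul_nonneg hε.le (sub_nonneg.2 hτ.1)
        have hεh : 0 < ε * h := mul_pos hε hhpos
        have hXb : X τ ∈ Metric.closedBall (0 : Space n) (r + 1) := by
          rw [mem_closedBall_zero_iff, hτX]
          linarith
        have hτI : τ ∈ Icc 0 T := ⟨htI0.1.trans hτ.1, by linarith [hτ.2]⟩
        have hut0 : u t (X τ) = 0 := hut _ (by rw [hτX]; linarith)
        have := hL.dist_le_mul (τ, X τ) ⟨hτI, hXb⟩ (t, X τ) ⟨htI0, hXb⟩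
        simp only [hut0, Prod.dist_eq, dist_self, dist_zero_right] at this
        rw [max_eq_left dist_nonneg, Real.dist_eq, abs_of_nonneg (sub_nonneg.2 hτ.1)] at this
        have h5 : L * (τ - t) ≤ L * h := by gcongr; linarith [hτ.2]
        linarith
  intro t ht x hx
  rcases ht.1.eq_or_lt with rfl | ht0
  · exact h0 x hx
  set d := ‖x‖ - R₀ with hd
  have hd0 : 0 < d := sub_pos.2 hx
  have hU1 : 0 < U + 1 := by linarith
  have hT1 : 0 < T + 1 := by linarith
  -- The initial growth `U t₀` takes at most half of the gap `d`, and the speed `ε` chosen below at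
  -- most a quarter.
  set t₀ := min (t / 2) (d / 2 / (U + 1)) with ht₀
  have ht₀0 : 0 < t₀ := lt_min (by linarith) (by positivity)
  have ht₀t : t₀ ≤ t / 2 := min_le_left _ _
  have h1 : U * t₀ ≤ d / 2 := by
    have : t₀ ≤ d / 2 / (U + 1) := min_le_right _ _
    rw [le_div_iff₀ hU1] at this
    nlinarith
  refine hind t₀ ⟨ht₀0, by linarith [ht.2]⟩ (d / 4 / (T + 1)) (by positivity) t
    ⟨by linarith, ht.2⟩ x ?_
  have h2 : d / 4 / (T + 1) * (t - t₀) ≤ d / 4 := by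
    rw [div_mul_eq_mul_div, div_le_iff₀ hT1]
    gcongr
    linarith [ht.2]
  linarith

end CNS

/-! ### Stress, dissipation and the equations in vacuum -/

namespace CNS

section Stress

variable {n : ℕ}

/-- The viscous dissipation `∇v : 𝒯`. -/
noncomputable def dissipation (μ lam : ℝ) (v : Space n → Space n) (x : Space n) : ℝ :=
  ∑ j, ∑ i, pderiv j (fun y => v y i) x * stress μ lam v i j x

theorem contDiff_divergence {v : Space n → Space n} (hv : ContDiff ℝ 2 v) :
    ContDiff ℝ 1 (divergence v) :=
  ContDiff.sum fun j _ => contDiff_pderiv (contDiff_coord hv j) (by norm_num) j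

theorem contDiff_stress {v : Space n → Space n} (hv : ContDiff ℝ 2 v) (μ lam : ℝ) (i j : Fin n) :
    ContDiff ℝ 1 (stress μ lam v i j) := by
  have h1 : ∀ i j, ContDiff ℝ 1 (pderiv j fun y => v y i) := fun i j =>
    contDiff_pderiv (contDiff_coord hv i) (by norm_num) j
  have h2 : ContDiff ℝ 1 fun x => if i = j then lam * divergence v x else 0 := by
    split_ifs
    · exact contDiff_const.mul (contDiff_divergence hv)
    · exact contDiff_const
  exact (contDiff_const.mul ((h1 i j).add (h1 j i))).add h2

theorem continuous_dissipation {v : Space n → Space n} (hv : ContDiff ℝ 2 v) (μ lam : ℝ) :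
    Continuous (dissipation μ lam v) := by
  refine continuous_finsetSum _ fun j _ => continuous_finsetSum _ fun i _ => ?_
  exact (contDiff_pderiv (contDiff_coord hv i) (l := 1) (by norm_num) j).continuous.mul
    (contDiff_stress hv μ lam i j).continuous

/-- The product rule separates the dissipation from the work of the viscous force; the latter drops
out in vacuum. -/
theorem sum_pderiv_velocity_stress {v : Space n → Space n} (hv : ContDiff ℝ 2 v) (μ lam : ℝ)
    (x : Space n) :
    ∑ j, pderiv j (fun y => ∑ i, v y i * stress μ lam v i j y) x
      = dissipation μ lam v x + ∑ i, v x i * ∑ j, pderiv j (stress μ lam v i j) x := by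
  have hvd : ∀ i, DifferentiableAt ℝ (fun y => v y i) x := fun i =>
    (contDiff_coord hv i).differentiable two_ne_zero x
  have hsd : ∀ i j, DifferentiableAt ℝ (stress μ lam v i j) x := fun i j =>
    (contDiff_stress hv μ lam i j).differentiable one_ne_zero x
  have h1 : ∀ j, pderiv j (fun y => ∑ i, v y i * stress μ lam v i j y) x
      = ∑ i, (v x i * pderiv j (stress μ lam v i j) x
        + stress μ lam v i j x * pderiv j (fun y => v y i) x) := fun j => by
    rw [pderiv_sum fun i _ => (hvd i).fun_mul (hsd i j)]
    exact Finset.sum_congr rfl fun i _ => pderiv_mul (hvd i) (hsd i j) j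
  simp only [h1, Finset.sum_add_distrib, dissipation, Finset.mul_sum]
  rw [add_comm]
  congr 1
  · exact Finset.sum_congr rfl fun j _ => Finset.sum_congr rfl fun i _ => mul_comm _ _
  · exact Finset.sum_comm

/-- The right side is `μ / 2` times the sum `S` of squares plus `lam` times the squared trace, and
Cauchy–Schwarz bounds the squared trace by `n / 4 * S`. The two entries of the minimum are the
constants for `lam ≥ 0` and `lam ≤ 0`. -/
theorem exists_mul_sum_sq_le {μ lam : ℝ} (hμ : 0 < μ) (hlam : 0 < 2 * μ + n * lam) :
    ∃ c > 0, ∀ a : Fin n → Fin n → ℝ, c * ∑ i, ∑ j, (a i j + a j i) ^ 2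
      ≤ ∑ j, ∑ i, a i j * (μ * (a i j + a j i) + if i = j then lam * ∑ k, a k k else 0) := by
  have key : ∀ a : Fin n → Fin n → ℝ,
      ∑ j, ∑ i, a i j * (μ * (a i j + a j i) + if i = j then lam * ∑ k, a k k else 0)
        = μ / 2 * ∑ i, ∑ j, (a i j + a j i) ^ 2 + lam * (∑ k, a k k) ^ 2 := by
    intro a
    have h1 : ∑ j, ∑ i, a i j * (if i = j then lam * ∑ k, a k k else 0)
        = lam * (∑ k, a k k) ^ 2 := by
      simp only [mul_ite, mul_zero, Finset.sum_ite_eq', Finset.mem_univ, if_true]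
      rw [← Finset.sum_mul]
      ring
    have h2 : ∑ j, ∑ i, a i j * (μ * (a i j + a j i))
        = μ / 2 * ∑ i, ∑ j, (a i j + a j i) ^ 2 := by
      have h3 : ∑ j, ∑ i, a i j * (μ * (a i j + a j i))
          = ∑ i, ∑ j, a i j * (μ * (a i j + a j i)) := Finset.sum_comm
      have h4 : ∑ j, ∑ i, a i j * (μ * (a i j + a j i))
          = ∑ i, ∑ j, a j i * (μ * (a i j + a j i)) :=
        Finset.sum_congr rfl fun i _ => Finset.sum_congr rfl fun j _ => by ring
      have h5 : ∑ i, ∑ j, a i j * (μ * (a i j + a j i)) + ∑ i, ∑ j, a j i * (μ * (a i j + a j i))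
          = μ * ∑ i, ∑ j, (a i j + a j i) ^ 2 := by
        simp only [← Finset.sum_add_distrib, Finset.mul_sum]
        exact Finset.sum_congr rfl fun i _ => Finset.sum_congr rfl fun j _ => by ring
      linarith
    simp only [mul_add, Finset.sum_add_distrib] at *
    rw [h1, h2]
  refine ⟨min (μ / 2) ((2 * μ + n * lam) / 4), lt_min (by positivity) (by positivity), fun a => ?_⟩
  rw [key]
  set S := ∑ i, ∑ j, (a i j + a j i) ^ 2 with hS
  have hS0 : 0 ≤ S := Finset.sum_nonneg fun i _ => Finset.sum_nonneg fun j _ => sq_nonneg _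
  have htr : (∑ k, a k k) ^ 2 ≤ n / 4 * S := by
    have h1 : (∑ k, a k k) ^ 2 ≤ n * ∑ k, a k k ^ 2 := by
      simpa using sq_sum_le_card_mul_sum_sq (s := (Finset.univ : Finset (Fin n)))
        (f := fun k => a k k)
    have h2 : ∑ k, 4 * a k k ^ 2 ≤ S := by
      refine Finset.sum_le_sum fun i _ => ?_
      refine le_trans (le_of_eq ?_) (Finset.single_le_sum (f := fun j => (a i j + a j i) ^ 2)
        (fun j _ => sq_nonneg _) (Finset.mem_univ i))
      ring
    rw [← Finset.mul_sum] at h2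
    have h3 : (n : ℝ) * (4 * ∑ k, a k k ^ 2) ≤ n * S := by gcongr
    linarith
  rcases le_total 0 lam with h | h
  · have := mul_nonneg h (sq_nonneg (∑ k, a k k))
    have h1 : min (μ / 2) ((2 * μ + n * lam) / 4) * S ≤ μ / 2 * S :=
      mul_le_mul_of_nonneg_right (min_le_left _ _) hS0
    linarith
  · have h1 : min (μ / 2) ((2 * μ + n * lam) / 4) * S ≤ (2 * μ + n * lam) / 4 * S :=
      mul_le_mul_of_nonneg_right (min_le_right _ _) hS0
    have h2 := mul_le_mul_of_nonpos_left htr h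
    linarith

/-- The dissipation controls the symmetric gradient. -/
theorem exists_mul_sum_sq_le_dissipation {μ lam : ℝ} (hμ : 0 < μ) (hlam : 0 < 2 * μ + n * lam) :
    ∃ c > 0, ∀ (v : Space n → Space n) (x : Space n),
      c * ∑ i, ∑ j, (pderiv j (fun y => v y i) x + pderiv i (fun y => v y j) x) ^ 2
        ≤ dissipation μ lam v x := by
  obtain ⟨c, hc, h⟩ := exists_mul_sum_sq_le (n := n) hμ hlam
  exact ⟨c, hc, fun v x => h fun i j => pderiv j (fun y => v y i) x⟩

theorem dissipation_nonneg {μ lam : ℝ} (hμ : 0 < μ) (hlam : 0 < 2 * μ + n * lam)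
    (v : Space n → Space n) (x : Space n) : 0 ≤ dissipation μ lam v x := by
  obtain ⟨c, hc, h⟩ := exists_mul_sum_sq_le_dissipation hμ hlam
  refine le_trans ?_ (h v x)
  exact mul_nonneg hc.le (Finset.sum_nonneg fun i _ => Finset.sum_nonneg fun j _ => sq_nonneg _)

theorem symm_gradient_eq_zero {μ lam : ℝ} (hμ : 0 < μ) (hlam : 0 < 2 * μ + n * lam)
    {v : Space n → Space n} {x : Space n} (hD : dissipation μ lam v x = 0) (i j : Fin n) :
    pderiv j (fun y => v y i) x + pderiv i (fun y => v y j) x = 0 := by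
  obtain ⟨c, hc, h⟩ := exists_mul_sum_sq_le_dissipation hμ hlam
  have h1 := h v x
  rw [hD] at h1
  have h2 : ∑ i, ∑ j, (pderiv j (fun y => v y i) x + pderiv i (fun y => v y j) x) ^ 2 = 0 :=
    le_antisymm (by by_contra! h3; have := mul_pos hc h3; linarith)
      (Finset.sum_nonneg fun i _ => Finset.sum_nonneg fun j _ => sq_nonneg _)
  rw [Finset.sum_eq_zero_iff_of_nonneg fun i _ => Finset.sum_nonneg fun j _ => sq_nonneg _] at h2
  have h3 := h2 i (Finset.mem_univ i)
  rw [Finset.sum_eq_zero_iff_of_nonneg fun j _ => sq_nonneg _] at h3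
  exact pow_eq_zero_iff two_ne_zero |>.1 (h3 j (Finset.mem_univ j))

end Stress

section Solution

variable {n : ℕ} {R γ μ lam K T : ℝ} {ρ : ℝ → Space n → ℝ} {u : ℝ → Space n → Space n}
  {s θ : ℝ → Space n → ℝ}

/-- With the pressure in place of `ρ θ`, regularity and sign of the energy follow from the state
equation, without any information on `θ`. -/
theorem energyDensity_eq (R γ : ℝ) (ρ : ℝ → Space n → ℝ) (u : ℝ → Space n → Space n)
    (θ : ℝ → Space n → ℝ) (t : ℝ) (x : Space n) :
    energyDensity R γ ρ u θ t x = 1 / 2 * ρ t x * ‖u t x‖ ^ 2 + pressure R ρ θ t x / (γ - 1) := by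
  simp only [energyDensity, pressure, specificHeat]
  ring

theorem pressure_eq_zero {t : ℝ} {x : Space n} (h : ρ t x = 0) : pressure R ρ θ t x = 0 := by
  simp [pressure, h]

theorem energyDensity_eq_zero {t : ℝ} {x : Space n} (h : ρ t x = 0) :
    energyDensity R γ ρ u θ t x = 0 := by
  simp [energyDensity, h]

/-- The state equation gives the pressure in terms of `s` and `ρ`, and `y ↦ y ^ γ` is `C¹` across `y
= 0` because `γ > 1`. -/
theorem IsClassicalSolution.contDiffOn_pressure (h : IsClassicalSolution R γ μ lam K T ρ u s θ)
    (hγ : 1 < γ) : ContDiffOn ℝ 1 (fun q : ℝ × Space n => pressure R ρ θ q.1 q.2)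
      (Icc 0 T ×ˢ univ) := by
  have h1 : ContDiffOn ℝ 1 (fun q : ℝ × Space n =>
      Real.exp (s q.1 q.2 / specificHeat R γ) * ρ q.1 q.2 ^ γ) (Icc 0 T ×ˢ univ) := by
    refine (h.contDiff_entropy.div_const _).exp.mul ?_
    exact (Real.contDiff_rpow_const_of_le (n := 1) (by exact_mod_cast hγ.le)).comp_contDiffOn
      h.contDiff_density
  exact h1.congr fun q hq => h.state q.1 hq.1 q.2

theorem IsClassicalSolution.contDiffOn_energyDensity
    (h : IsClassicalSolution R γ μ lam K T ρ u s θ) (hγ : 1 < γ) :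
    ContDiffOn ℝ 1 (fun q : ℝ × Space n => energyDensity R γ ρ u θ q.1 q.2)
      (Icc 0 T ×ˢ univ) := by
  simp only [energyDensity_eq]
  exact ((contDiffOn_const.mul h.contDiff_density).mul (h.contDiff_velocity.norm_sq ℝ)).add
    ((h.contDiffOn_pressure hγ).div_const _)

theorem IsClassicalSolution.pressure_nonneg (h : IsClassicalSolution R γ μ lam K T ρ u s θ)
    {t : ℝ} (ht : t ∈ Icc 0 T) (x : Space n) : 0 ≤ pressure R ρ θ t x := by
  rw [h.state t ht x]
  exact mul_nonneg (Real.exp_pos _).le (Real.rpow_nonneg (h.density_nonneg t ht x) _)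

theorem IsClassicalSolution.energyDensity_nonneg (h : IsClassicalSolution R γ μ lam K T ρ u s θ)
    (hγ : 1 < γ) {t : ℝ} (ht : t ∈ Icc 0 T) (x : Space n) : 0 ≤ energyDensity R γ ρ u θ t x := by
  rw [energyDensity_eq]
  have h1 := h.density_nonneg t ht x
  have h2 := h.pressure_nonneg ht x
  have h3 : 0 < γ - 1 := sub_pos.2 hγ
  positivity

/-- A zero of a nonnegative function is a minimum. This removes the first-order terms from the
equations at each vacuum point, including points on the boundary of the vacuum. -/
theorem deriv_eq_zero_of_nonneg {f : ℝ → Space n → ℝ}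
    (hf : ∀ t ∈ Icc 0 T, ∀ x, 0 ≤ f t x) {t : ℝ} (ht : t ∈ Ioo 0 T) {x : Space n}
    (hx : f t x = 0) : deriv (fun τ => f τ x) t = 0 := by
  refine IsLocalMin.deriv_eq_zero ?_
  filter_upwards [Icc_mem_nhds ht.1 ht.2] with τ hτ
  rw [hx]
  exact hf τ hτ x

theorem fderiv_eq_zero_of_nonneg {f : Space n → ℝ} (hf : ∀ x, 0 ≤ f x) {x : Space n}
    (hx : f x = 0) : fderiv ℝ f x = 0 :=
  IsLocalMin.fderiv_eq_zero (Eventually.of_forall fun y => by rw [hx]; exact hf y)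

theorem pderiv_eq_zero_of_nonneg {f : Space n → ℝ} (hf : ∀ x, 0 ≤ f x) {x : Space n}
    (hx : f x = 0) (j : Fin n) : pderiv j f x = 0 := by
  rw [pderiv, fderiv_eq_zero_of_nonneg hf hx]
  rfl

theorem divergence_smul_eq_zero {f : Space n → ℝ} (hf : ∀ x, 0 ≤ f x) {v : Space n → Space n}
    {x : Space n} (hx : f x = 0) (hfd : DifferentiableAt ℝ f x) (hv : DifferentiableAt ℝ v x) :
    divergence (fun y => f y • v y) x = 0 := by
  rw [divergence_smul hfd hv, hx, zero_mul, zero_add]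
  exact Finset.sum_eq_zero fun j _ => by rw [pderiv_eq_zero_of_nonneg hf hx, mul_zero]

/-- In vacuum the viscous force vanishes. -/
theorem IsClassicalSolution.sum_pderiv_stress_eq_zero
    (h : IsClassicalSolution R γ μ lam K T ρ u s θ) {t : ℝ} (ht : t ∈ Ioo 0 T)
    {x : Space n} (hx : ρ t x = 0) (i : Fin n) :
    ∑ j, pderiv j (stress μ lam (u t) i j) x = 0 := by
  have ht' := Ioo_subset_Icc_self ht
  rw [← h.momentum t ht x i]
  have hρd := (contDiff_slice h.contDiff_density ht').differentiable one_ne_zero x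
  have hud := fun i => differentiableAt_coord
    ((contDiff_slice h.contDiff_velocity ht').differentiable one_ne_zero x) i
  have h1 : deriv (fun τ => ρ τ x * u τ x i) t = 0 := by
    have hu := hasDerivAt_slice (f := fun t x => u t x i)
      ((EuclideanSpace.proj (𝕜 := ℝ) i).contDiff.comp_contDiffOn h.contDiff_velocity) ht x
    have hρ := hasDerivAt_slice h.contDiff_density ht x
    rw [(hρ.fun_mul hu).deriv, ← hρ.deriv, deriv_eq_zero_of_nonneg h.density_nonneg ht hx, hx]
    simp
  have h2 : ∀ j, pderiv j (fun y => ρ t y * u t y i * u t y j) x = 0 := fun j => by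
    rw [pderiv_mul (hρd.fun_mul (hud i)) (hud j), pderiv_mul hρd (hud i),
      pderiv_eq_zero_of_nonneg (h.density_nonneg t ht') hx, hx]
    simp
  have h3 : pderiv i (pressure R ρ θ t) x = 0 :=
    pderiv_eq_zero_of_nonneg (h.pressure_nonneg ht') (pressure_eq_zero hx) i
  simp [h1, h2, h3]

/-- In vacuum the viscous heating is balanced by the heat conduction. -/
theorem IsClassicalSolution.dissipation_add_laplacian_eq_zero
    (h : IsClassicalSolution R γ μ lam K T ρ u s θ) (hγ : 1 < γ) {t : ℝ} (ht : t ∈ Ioo 0 T)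
    {x : Space n} (hx : ρ t x = 0) :
    dissipation μ lam (u t) x + K * Laplacian.laplacian (θ t) x = 0 := by
  have ht' := Ioo_subset_Icc_self ht
  have hE := h.energy t ht x
  have hud := (contDiff_slice h.contDiff_velocity ht').differentiable one_ne_zero x
  have h1 : deriv (fun τ => energyDensity R γ ρ u θ τ x) t = 0 :=
    deriv_eq_zero_of_nonneg (fun t ht x => h.energyDensity_nonneg hγ ht x) ht
      (energyDensity_eq_zero hx)
  have h2 : divergence (fun y => (energyDensity R γ ρ u θ t y + pressure R ρ θ t y) • u t y) x
      = 0 := by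
    refine divergence_smul_eq_zero (f := fun y => energyDensity R γ ρ u θ t y + pressure R ρ θ t y)
      (fun y => add_nonneg (h.energyDensity_nonneg hγ ht' y) (h.pressure_nonneg ht' y)) ?_ ?_ hud
    · rw [energyDensity_eq_zero hx, pressure_eq_zero hx, add_zero]
    · exact ((contDiff_slice (h.contDiffOn_energyDensity hγ) ht').differentiable one_ne_zero x).add
        ((contDiff_slice (h.contDiffOn_pressure hγ) ht').differentiable one_ne_zero x)
  rw [h1, h2, sum_pderiv_velocity_stress (h.contDiff_two_velocity t ht')] at hE
  simp only [h.sum_pderiv_stress_eq_zero ht hx, mul_zero, Finset.sum_const_zero] at hE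
  linarith

end Solution

end CNS

/-! ### Velocity fields without deformation in exterior domains -/

namespace CNS

variable {n : ℕ}

theorem pderiv_pderiv_eq_fderiv_fderiv {f : Space n → ℝ} (hf : ContDiff ℝ 2 f) (i j : Fin n)
    (x : Space n) : pderiv i (pderiv j f) x
      = fderiv ℝ (fderiv ℝ f) x (EuclideanSpace.single i 1) (EuclideanSpace.single j 1) := by
  have hd : DifferentiableAt ℝ (fderiv ℝ f) x :=
    ((hf.fderiv_right (m := 1) (by norm_num)).differentiable one_ne_zero) x
  have h := (hd.hasFDerivAt.clm_apply
    (hasFDerivAt_const (EuclideanSpace.single j (1 : ℝ) : Space n) x)).fderiv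
  unfold pderiv
  rw [h]
  simp

theorem pderiv_comm {f : Space n → ℝ} (hf : ContDiff ℝ 2 f) (i j : Fin n) (x : Space n) :
    pderiv i (pderiv j f) x = pderiv j (pderiv i f) x := by
  rw [pderiv_pderiv_eq_fderiv_fderiv hf, pderiv_pderiv_eq_fderiv_fderiv hf,
    (hf.contDiffAt (x := x)).isSymmSndFDerivAt (by simp)]

theorem fderiv_eq_zero_of_pderiv {f : Space n → ℝ} {x : Space n} (h : ∀ j, pderiv j f x = 0) :
    fderiv ℝ f x = 0 := by
  ext v
  simp [fderiv_apply_eq_sum_pderiv, h]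

/-- Second derivatives of an infinitesimal rigid motion vanish. -/
theorem pderiv_pderiv_eq_zero_of_symm_gradient {v : Space n → Space n} (hv : ContDiff ℝ 2 v)
    {Ω : Set (Space n)} (hΩ : IsOpen Ω)
    (h : ∀ x ∈ Ω, ∀ i j, pderiv j (fun y => v y i) x + pderiv i (fun y => v y j) x = 0)
    {x : Space n} (hx : x ∈ Ω) (i j k : Fin n) :
    pderiv k (pderiv j fun y => v y i) x = 0 := by
  have hsymm : ∀ i j k, pderiv k (pderiv j fun y => v y i) x = pderiv j (pderiv k fun y => v y i) x :=
    fun i j k => pderiv_comm (contDiff_coord hv i) k j x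
  have hanti : ∀ i j k, pderiv k (pderiv j fun y => v y i) x
      = -pderiv k (pderiv i fun y => v y j) x := by
    intro i j k
    have hd : ∀ i j, DifferentiableAt ℝ (pderiv j fun y => v y i) x := fun i j =>
      (contDiff_pderiv (contDiff_coord hv i) (l := 1) (by norm_num) j).differentiable one_ne_zero x
    have h1 := pderiv_add (hd i j) (hd j i) k
    rw [pderiv_eq_zero_of_eventually] at h1
    · linarith
    · filter_upwards [hΩ.mem_nhds hx] with y hy using h y hy i j
  -- The second derivatives are symmetric in the two differentiations and antisymmetric in component
  -- and first differentiation. Three swaps of each kind return to the start with the opposite sign.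
  have h1 := hanti i j k
  have h2 := hsymm j i k
  have h3 := hanti j k i
  have h4 := hsymm k j i
  have h5 := hanti k i j
  have h6 := hsymm i k j
  linarith

/-- A bounded `C²` function whose second derivatives vanish in an exterior domain has vanishing
gradient there. -/
theorem pderiv_eq_zero_of_bounded {f : Space n → ℝ} (hf : ContDiff ℝ 2 f) {A r : ℝ}
    (hA : ∀ x, |f x| ≤ A) (h : ∀ x, r < ‖x‖ → ∀ j k, pderiv k (pderiv j f) x = 0)
    {x : Space n} (hx : r < ‖x‖) (j : Fin n) : pderiv j f x = 0 := by
  -- The sign directs the ray from `x` along the `j`-th axis away from the origin, so it stays in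
  -- the exterior domain; there `f` is affine with slope `± pderiv j f x`.
  obtain ⟨σ, hσ, hσx⟩ : ∃ σ : ℝ, (σ = 1 ∨ σ = -1) ∧ 0 ≤ σ * x j := by
    rcases le_total 0 (x j) with h | h
    · exact ⟨1, Or.inl rfl, by simpa using h⟩
    · exact ⟨-1, Or.inr rfl, by simpa using h⟩
  set e : Space n := EuclideanSpace.single j 1 with he
  have hray : ∀ t : ℝ, 0 ≤ t → r < ‖x + (t * σ) • e‖ := by
    intro t ht
    refine hx.trans_le (le_of_sq_le_sq ?_ (norm_nonneg _))
    rw [norm_add_sq_real, real_inner_smul_right]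
    have h1 : ⟪x, e⟫_ℝ = x j := by simp [he, EuclideanSpace.inner_single_right]
    rw [h1]
    have h2 : 0 ≤ t * (σ * x j) := mul_nonneg ht hσx
    nlinarith [sq_nonneg ‖(t * σ) • e‖]
  have hline : ∀ t : ℝ, HasDerivAt (fun t : ℝ => x + (t * σ) • e) (σ • e) t := fun t => by
    simpa using (((hasDerivAt_id t).mul_const σ).smul_const e).const_add x
  have hconst : ∀ t : ℝ, 0 ≤ t → pderiv j f (x + (t * σ) • e) = pderiv j f x := by
    intro t ht
    have hd : ∀ τ ∈ Icc 0 t, HasDerivAt (fun τ : ℝ => pderiv j f (x + (τ * σ) • e)) 0 τ := by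
      intro τ hτ
      have hpd := (contDiff_pderiv hf (l := 1) (by norm_num) j).differentiable one_ne_zero
        (x + (τ * σ) • e)
      have h1 := hpd.hasFDerivAt.comp_hasDerivAt τ (hline τ)
      rw [fderiv_eq_zero_of_pderiv (h _ (hray τ hτ.1) j)] at h1
      simpa using! h1
    have := constant_of_has_deriv_right_zero
      (fun τ hτ => (hd τ hτ).continuousAt.continuousWithinAt)
      (fun τ hτ => (hd τ (Ico_subset_Icc_self hτ)).hasDerivWithinAt) t (right_mem_Icc.2 ht)
    simpa using this
  have hlin : ∀ t : ℝ, 0 ≤ t → f (x + (t * σ) • e) - t * (σ * pderiv j f x) = f x := by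
    intro t ht
    have hd : ∀ τ ∈ Icc 0 t,
        HasDerivAt (fun τ : ℝ => f (x + (τ * σ) • e) - τ * (σ * pderiv j f x)) 0 τ := by
      intro τ hτ
      have h1 := (hf.differentiable two_ne_zero (x + (τ * σ) • e)).hasFDerivAt.comp_hasDerivAt τ
        (hline τ)
      refine (h1.sub ((hasDerivAt_id τ).mul_const (σ * pderiv j f x))).congr_deriv ?_
      rw [map_smul, ← hconst τ hτ.1]
      simp [pderiv, he]
    have := constant_of_has_deriv_right_zero
      (fun τ hτ => (hd τ hτ).continuousAt.continuousWithinAt)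
      (fun τ hτ => (hd τ (Ico_subset_Icc_self hτ)).hasDerivWithinAt) t (right_mem_Icc.2 ht)
    simpa using this
  by_contra hne
  have hpos : 0 < |pderiv j f x| := abs_pos.2 hne
  have hA0 : 0 ≤ A := (abs_nonneg _).trans (hA 0)
  -- Over this length `f` would change by `2 * A + 1`, more than the bound `A` permits.
  set t := (2 * A + 1) / |pderiv j f x| with ht
  have ht0 : 0 ≤ t := by positivity
  have h1 := hlin t ht0
  have h2 : |t * (σ * pderiv j f x)| = 2 * A + 1 := by
    have hσ1 : |σ| = 1 := by rcases hσ with rfl | rfl <;> simp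
    rw [abs_mul, abs_mul, hσ1, one_mul, abs_of_nonneg ht0, ht]
    field_simp
  have h3 : t * (σ * pderiv j f x) = f (x + (t * σ) • e) - f x := by linarith
  rw [h3] at h2
  have := abs_sub (f (x + (t * σ) • e)) (f x)
  linarith [hA x, hA (x + (t * σ) • e)]

/-- The half-space contains a ball of every radius `r`, centred at `(1 + r / ‖x‖) • x`. -/
theorem volume_halfSpace {x : Space n} (hx : x ≠ 0) {a : ℝ} (ha : a < ‖x‖ ^ 2) :
    volume {y : Space n | a < ⟪x, y⟫_ℝ} = ⊤ := by
  have hx0 : 0 < ‖x‖ := norm_pos_iff.2 hx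
  have : Nontrivial (Space n) := nontrivial_of_ne x 0 hx
  have hball : ∀ r : ℝ, 0 ≤ r → ENNReal.ofReal (r ^ Module.finrank ℝ (Space n)) *
      volume (Metric.ball (0 : Space n) 1) ≤ volume {y : Space n | a < ⟪x, y⟫_ℝ} := by
    intro r hr
    rw [← Measure.addHaar_ball volume ((1 + r / ‖x‖) • x) hr]
    refine measure_mono fun y hy => ?_
    rw [Metric.mem_ball, dist_eq_norm] at hy
    have h1 : ⟪x, y⟫_ℝ = ⟪x, y - (1 + r / ‖x‖) • x⟫_ℝ + (1 + r / ‖x‖) * ‖x‖ ^ 2 := by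
      rw [inner_sub_right, real_inner_smul_right, real_inner_self_eq_norm_sq]
      ring
    have h2 := abs_le.1 (abs_real_inner_le_norm x (y - (1 + r / ‖x‖) • x))
    have h3 : ‖x‖ * ‖y - (1 + r / ‖x‖) • x‖ ≤ ‖x‖ * r := by gcongr
    have h4 : (1 + r / ‖x‖) * ‖x‖ ^ 2 = ‖x‖ ^ 2 + ‖x‖ * r := by field_simp
    rw [mem_ofPred_eq, h1, h4]
    linarith [h2.1]
  by_contra hne
  have hV : 0 < volume (Metric.ball (0 : Space n) 1) := Metric.measure_ball_pos _ _ one_pos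
  have hV' : volume (Metric.ball (0 : Space n) 1) ≠ ⊤ := measure_ball_lt_top.ne
  have ht : Tendsto (fun r : ℝ => r ^ Module.finrank ℝ (Space n)) atTop atTop :=
    tendsto_pow_atTop Module.finrank_pos.ne'
  have hfin : volume {y : Space n | a < ⟪x, y⟫_ℝ} / volume (Metric.ball (0 : Space n) 1) ≠ ⊤ :=
    ENNReal.div_ne_top hne hV.ne'
  obtain ⟨r, hr, hr0⟩ := ((ht.eventually_gt_atTop
    (volume {y : Space n | a < ⟪x, y⟫_ℝ} / volume (Metric.ball (0 : Space n) 1)).toReal).and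
    (eventually_ge_atTop 0)).exists
  have h1 := (ENNReal.le_div_iff_mul_le (Or.inl hV.ne') (Or.inl hV')).2 (hball r hr0)
  rw [ENNReal.ofReal_le_iff_le_toReal hfin] at h1
  linarith

/-- A half-space through `x` lies in the exterior domain. It is convex, so `f` is constant on it,
and of infinite volume, so the constant is zero. The whole exterior would not do: it is disconnected
in dimension one. -/
theorem eq_zero_of_pderiv_eq_zero_of_memLp {f : Space n → ℝ} (hf : Differentiable ℝ f)
    (hf2 : MemLp f 2) {r : ℝ} (hr : 0 ≤ r) (h : ∀ x, r < ‖x‖ → ∀ j, pderiv j f x = 0)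
    {x : Space n} (hx : r < ‖x‖) : f x = 0 := by
  have hx0 : 0 < ‖x‖ := hr.trans_lt hx
  set H : Set (Space n) := {y | r * ‖x‖ < ⟪x, y⟫_ℝ} with hH
  have hHo : IsOpen H := isOpen_lt continuous_const (by fun_prop)
  have hHc : Convex ℝ H := convex_halfSpace_gt (innerSL ℝ x).toLinearMap.isLinear _
  have hxH : x ∈ H := by
    rw [hH, mem_ofPred_eq, real_inner_self_eq_norm_sq]
    nlinarith
  have hsub : ∀ y ∈ H, r < ‖y‖ := by
    intro y hy
    have h1 := real_inner_le_norm x y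
    have h2 : r * ‖x‖ < ‖y‖ * ‖x‖ := by
      rw [hH, mem_ofPred_eq] at hy
      linarith
    exact lt_of_mul_lt_mul_right h2 hx0.le
  have hconst : ∀ y ∈ H, f y = f x := fun y hy =>
    hHo.is_const_of_fderiv_eq_zero hHc.isPreconnected hf.differentiableOn
      (fun z hz => fderiv_eq_zero_of_pderiv (h z (hsub z hz))) hy hxH
  have h1 : MemLp (fun _ : Space n => f x) 2 (volume.restrict H) := by
    refine (hf2.restrict H).ae_eq ?_
    filter_upwards [ae_restrict_mem hHo.measurableSet] with y hy using hconst y hy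
  rw [memLp_const_iff two_ne_zero ENNReal.ofNat_ne_top] at h1
  refine h1.resolve_right fun h2 => ?_
  rw [Measure.restrict_apply_univ, hH, volume_halfSpace (norm_pos_iff.1 hx0) (by nlinarith)] at h2
  exact lt_irrefl _ h2

/-- A bounded square integrable velocity field without deformation in an exterior domain vanishes
there. -/
theorem eq_zero_of_symm_gradient_eq_zero {v : Space n → Space n} (hv : ContDiff ℝ 2 v) {A r : ℝ}
    (hA : ∀ i x, |v x i| ≤ A) (hv2 : ∀ i, MemLp (fun x => v x i) 2) (hr : 0 ≤ r)
    (h : ∀ x, r < ‖x‖ → ∀ i j, pderiv j (fun y => v y i) x + pderiv i (fun y => v y j) x = 0)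
    {x : Space n} (hx : r < ‖x‖) : v x = 0 := by
  ext i
  refine eq_zero_of_pderiv_eq_zero_of_memLp
    ((contDiff_coord hv i).differentiable two_ne_zero) (hv2 i) hr (fun y hy j => ?_) hx
  refine pderiv_eq_zero_of_bounded (contDiff_coord hv i) (hA i) (fun z hz j k => ?_) hy j
  exact pderiv_pderiv_eq_zero_of_symm_gradient hv (Ω := {z | r < ‖z‖})
    (isOpen_lt continuous_const continuous_norm) h hz i j k

end CNS

/-! ### Integration by parts and heat flux -/

namespace CNS

section Integration

variable {n : ℕ}

theorem hasCompactSupport_pderiv {f : Space n → ℝ} (hf : HasCompactSupport f) (j : Fin n) :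
    HasCompactSupport (pderiv j f) :=
  hf.fderiv_apply (𝕜 := ℝ) (EuclideanSpace.single j 1)

theorem continuous_pderiv {f : Space n → ℝ} (hf : ContDiff ℝ 1 f) (j : Fin n) :
    Continuous (pderiv j f) :=
  (contDiff_pderiv (l := 0) hf (by norm_num) j).continuous

theorem integral_mul_pderiv {f g : Space n → ℝ} (hf : ContDiff ℝ 1 f) (hg : ContDiff ℝ 1 g)
    (hgc : HasCompactSupport g) (j : Fin n) :
    ∫ x, g x * pderiv j f x = -∫ x, pderiv j g x * f x := by
  refine integral_mul_fderiv_eq_neg_fderiv_mul_of_integrable (v := EuclideanSpace.single j 1)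
    ?_ ?_ ?_ (fun x _ => hg.differentiable one_ne_zero x) (fun x _ => hf.differentiable one_ne_zero x)
  · exact ((continuous_pderiv hg j).mul hf.continuous).integrable_of_hasCompactSupport
      (hasCompactSupport_pderiv hgc j).mul_right
  · exact (hg.continuous.mul (continuous_pderiv hf j)).integrable_of_hasCompactSupport hgc.mul_right
  · exact (hg.continuous.mul hf.continuous).integrable_of_hasCompactSupport hgc.mul_right

theorem integral_pderiv_eq_zero {f : Space n → ℝ} (hf : ContDiff ℝ 1 f)
    (hfc : HasCompactSupport f) (j : Fin n) : ∫ x, pderiv j f x = 0 := by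
  have := integral_mul_pderiv (contDiff_const (c := (1 : ℝ))) hf hfc j
  simp only [mul_one] at this
  rw [← neg_eq_zero, ← this]
  simp [pderiv]

theorem laplacian_eq_sum_pderiv {f : Space n → ℝ} (hf : ContDiff ℝ 2 f) (x : Space n) :
    Laplacian.laplacian f x = ∑ j, pderiv j (pderiv j f) x := by
  rw [InnerProductSpace.laplacian_eq_iteratedFDeriv_orthonormalBasis f
    (EuclideanSpace.basisFun (Fin n) ℝ)]
  refine Finset.sum_congr rfl fun j _ => ?_
  rw [pderiv_pderiv_eq_fderiv_fderiv hf, iteratedFDeriv_two_apply]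
  simp

theorem continuous_laplacian {f : Space n → ℝ} (hf : ContDiff ℝ 2 f) :
    Continuous fun x => Laplacian.laplacian f x := by
  simp only [laplacian_eq_sum_pderiv hf]
  exact continuous_finsetSum _ fun j _ =>
    continuous_pderiv (contDiff_pderiv hf (by norm_num) j) j

theorem integral_mul_laplacian {f g : Space n → ℝ} (hf : ContDiff ℝ 2 f) (hg : ContDiff ℝ 1 g)
    (hgc : HasCompactSupport g) :
    ∫ x, g x * Laplacian.laplacian f x = -∑ j, ∫ x, pderiv j g x * pderiv j f x := by
  have hp : ∀ j, ContDiff ℝ 1 (pderiv j f) := fun j => contDiff_pderiv hf (by norm_num) j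
  simp only [laplacian_eq_sum_pderiv hf, Finset.mul_sum]
  rw [integral_finsetSum _ fun j _ => ?_, ← Finset.sum_neg_distrib]
  swap
  · exact (hg.continuous.mul
      (continuous_pderiv (hp j) j)).integrable_of_hasCompactSupport hgc.mul_right
  exact Finset.sum_congr rfl fun j _ => integral_mul_pderiv (hp j) hg hgc j

theorem abs_pderiv_le_norm_fderiv (f : Space n → ℝ) (x : Space n) (j : Fin n) :
    |pderiv j f x| ≤ ‖fderiv ℝ f x‖ := by
  refine ((fderiv ℝ f x).le_opNorm (EuclideanSpace.single j (1 : ℝ))).trans ?_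
  simp

/-- Cutoff functions with gradient of size `1 / r` on the annulus between radii `r` and `2 r`. -/
theorem exists_cutoff (n : ℕ) : ∃ C : ℝ, 0 ≤ C ∧ ∀ r : ℝ, 0 < r → ∃ χ : Space n → ℝ,
    ContDiff ℝ 1 χ ∧ HasCompactSupport χ ∧ (∀ x, 0 ≤ χ x) ∧ (∀ x, ‖x‖ ≤ r → χ x = 1) ∧
    (∀ x j, |pderiv j χ x| ≤ C / r) ∧
    ∀ x j, pderiv j χ x ≠ 0 → r ≤ ‖x‖ ∧ ‖x‖ ≤ 2 * r := by
  let b : ContDiffBump (0 : Space n) := ⟨1, 2, one_pos, one_lt_two⟩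
  have hbc : ContDiff ℝ 1 b := b.contDiff
  obtain ⟨C, hC⟩ := (hbc.continuous_fderiv one_ne_zero).bounded_above_of_compact_support
    (b.hasCompactSupport.fderiv ℝ)
  refine ⟨C, (norm_nonneg _).trans (hC 0), fun r hr => ?_⟩
  have hsm : ContDiff ℝ 1 fun x : Space n => r⁻¹ • x := contDiff_const_smul _
  have hone : ∀ x : Space n, ‖x‖ ≤ r → b (r⁻¹ • x) = 1 := by
    intro x hx
    apply b.one_of_mem_closedBall
    rw [mem_closedBall_zero_iff, norm_smul, norm_inv, Real.norm_of_nonneg hr.le]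
    show _ ≤ (1 : ℝ)
    rw [inv_mul_le_iff₀ hr]
    linarith
  have hzero : ∀ x : Space n, 2 * r ≤ ‖x‖ → b (r⁻¹ • x) = 0 := by
    intro x hx
    apply b.zero_of_le_dist
    rw [dist_zero_right, norm_smul, norm_inv, Real.norm_of_nonneg hr.le]
    show (2 : ℝ) ≤ _
    rw [le_inv_mul_iff₀ hr]
    linarith
  refine ⟨fun x => b (r⁻¹ • x), hbc.comp hsm, ?_, fun x => b.nonneg, hone, ?_, ?_⟩
  · exact HasCompactSupport.of_support_subset_isCompact (isCompact_closedBall (0 : Space n) (2 * r))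
      fun x hx => by
        rw [mem_closedBall_zero_iff]
        by_contra! h
        exact hx (hzero x h.le)
  · intro x j
    have h1 : HasFDerivAt (fun x : Space n => b (r⁻¹ • x)) _ x :=
      (hbc.differentiable one_ne_zero (r⁻¹ • x)).hasFDerivAt.comp x
        ((hasFDerivAt_id x).const_smul r⁻¹)
    refine (abs_pderiv_le_norm_fderiv _ x j).trans ?_
    rw [h1.fderiv]
    refine (ContinuousLinearMap.opNorm_comp_le _ _).trans ?_
    rw [div_eq_mul_inv]
    gcongr
    · exact (norm_nonneg _).trans (hC 0)
    · exact hC _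
    · rw [norm_smul, norm_inv, Real.norm_of_nonneg hr.le]
      exact mul_le_of_le_one_right (inv_nonneg.2 hr.le) ContinuousLinearMap.norm_id_le
  · intro x j hx
    refine ⟨?_, ?_⟩
    · by_contra! h
      refine hx ?_
      rw [pderiv_congr (g := fun _ => (1 : ℝ))]
      · simp [pderiv]
      · filter_upwards [continuous_norm.continuousAt.eventually (gt_mem_nhds h)] with y hy
        exact hone y hy.le
    · by_contra! h
      refine hx (pderiv_eq_zero_of_eventually ?_ j)
      filter_upwards [continuous_norm.continuousAt.eventually (lt_mem_nhds h)] with y hy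
      exact hzero y hy.le

/-- If the gradient of `θ` decays faster than `|x|^(1-n)`, there is no flux through infinity. -/
theorem exists_cutoff_integral_laplacian (hn : 1 ≤ n) {θ : Space n → ℝ} (hθ : ContDiff ℝ 2 θ)
    (hdecay : (fun x => gradient θ x) =o[cocompact (Space n)] fun x => 1 / ‖x‖ ^ (n - 1))
    (a : ℝ) {ε : ℝ} (hε : 0 < ε) : ∃ χ : Space n → ℝ, ContDiff ℝ 1 χ ∧ HasCompactSupport χ ∧
      (∀ x, 0 ≤ χ x) ∧ (∀ x, ‖x‖ ≤ a → χ x = 1) ∧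
      |∫ x, χ x * Laplacian.laplacian θ x| ≤ ε := by
  obtain ⟨C, hC, hχ⟩ := exists_cutoff n
  set V := (volume (Metric.closedBall (0 : Space n) 1)).toReal with hV
  have hV0 : 0 ≤ V := ENNReal.toReal_nonneg
  -- On the annulus the integrand is at most `(C / r) * (δ / r ^ (n - 1))`, and the ball of radius
  -- `2 * r` has volume `(2 * r) ^ n * V`; the powers of `r` cancel. The `+ 1` keeps the denominator
  -- positive.
  set δ := ε / (n * (C * 2 ^ n * V) + 1) with hδ
  have hδ0 : 0 < δ := by positivity
  have hev := hdecay.def hδ0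
  rw [← Metric.cobounded_eq_cocompact, Filter.Eventually, ← comap_norm_atTop,
    mem_comap] at hev
  obtain ⟨s, hs, hsub⟩ := hev
  obtain ⟨r₀, hr₀⟩ := mem_atTop_sets.1 hs
  set r := max (max a r₀) 1 with hr
  have hr1 : 0 < r := lt_of_lt_of_le one_pos (le_max_right _ _)
  obtain ⟨χ, h1, h2, h3, h4, h5, h6⟩ := hχ r hr1
  refine ⟨χ, h1, h2, h3, fun x hx => h4 x (hx.trans ((le_max_left _ _).trans (le_max_left _ _))), ?_⟩
  rw [integral_mul_laplacian hθ h1 h2, abs_neg]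
  have hpt : ∀ j x, ‖pderiv j χ x * pderiv j θ x‖
      ≤ (Metric.closedBall (0 : Space n) (2 * r)).indicator (fun _ => C * δ / r ^ n) x := by
    intro j x
    by_cases hx : pderiv j χ x = 0
    · rw [hx, zero_mul, norm_zero]
      exact indicator_nonneg (fun _ _ => by positivity) x
    · obtain ⟨hx1, hx2⟩ := h6 x j hx
      rw [indicator_of_mem (by rwa [mem_closedBall_zero_iff]), norm_mul]
      have hg : ‖pderiv j θ x‖ ≤ δ / r ^ (n - 1) := by
        have hxs : x ∈ norm ⁻¹' s :=
          hr₀ _ ((le_max_right a r₀).trans ((le_max_left _ _).trans hx1))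
        have h7 : ‖gradient θ x‖ ≤ δ * ‖1 / ‖x‖ ^ (n - 1)‖ := hsub hxs
        have h8 : ‖gradient θ x‖ = ‖fderiv ℝ θ x‖ := by simp [gradient]
        rw [h8, Real.norm_of_nonneg (by positivity), mul_one_div] at h7
        refine (abs_pderiv_le_norm_fderiv θ x j).trans (h7.trans ?_)
        gcongr
      calc ‖pderiv j χ x‖ * ‖pderiv j θ x‖ ≤ C / r * (δ / r ^ (n - 1)) := by
            gcongr
            exact h5 x j
        _ = C * δ / r ^ n := by
            rw [div_mul_div_comm, ← pow_succ', Nat.sub_add_cancel hn]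
  have hvol : (volume (Metric.closedBall (0 : Space n) (2 * r))).toReal = (2 * r) ^ n * V := by
    rw [Measure.addHaar_closedBall' volume _ (by positivity), ENNReal.toReal_mul,
      ENNReal.toReal_ofReal (by positivity), finrank_euclideanSpace_fin]
  have hj : ∀ j, |∫ x, pderiv j χ x * pderiv j θ x| ≤ C * 2 ^ n * V * δ := by
    intro j
    have hfin : volume (Metric.closedBall (0 : Space n) (2 * r)) ≠ ⊤ :=
      measure_closedBall_lt_top.ne
    refine (norm_integral_le_of_norm_le ?_ (Eventually.of_forall (hpt j))).trans (le_of_eq ?_)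
    · exact (integrableOn_const hfin).integrable_indicator measurableSet_closedBall
    · rw [integral_indicator measurableSet_closedBall, setIntegral_const, smul_eq_mul,
        measureReal_def, hvol, mul_pow]
      field_simp
  calc |∑ j, ∫ x, pderiv j χ x * pderiv j θ x| ≤ ∑ j : Fin n, C * 2 ^ n * V * δ :=
        (Finset.abs_sum_le_sum_abs _ _).trans (Finset.sum_le_sum fun j _ => hj j)
    _ = n * (C * 2 ^ n * V) * δ := by simp; ring
    _ ≤ ε := by
        rw [hδ, mul_div_assoc', div_le_iff₀ (by positivity)]
        nlinarith

/-- The heat flows out of the region where the temperature is positive. -/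
theorem setIntegral_laplacian_nonpos {θ q : Space n → ℝ} (hθ : ContDiff ℝ 2 θ)
    (hq : Continuous q) (hq0 : ∀ x, 0 ≤ q x) (hqc : HasCompactSupport q)
    (h : ∀ x, 0 < q x → θ x = q x) : ∫ x in {x | 0 < q x}, Laplacian.laplacian θ x ≤ 0 := by
  set G := {x | 0 < q x} with hG
  have hGo : IsOpen G := isOpen_lt continuous_const hq
  have hGq : ∀ {x}, x ∉ G → q x = 0 := fun {x} hx => le_antisymm (not_lt.1 hx) (hq0 x)
  -- Monotone steps, zero for `k y ≤ 1` and one for `k y ≥ 2`. Although `q` is only continuous, `φ k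
  -- ∘ q` is `C¹`: on `G` it is `φ k ∘ θ`, and near the complement it vanishes. Integration by parts
  -- against `Δθ` gives minus the integral of `φ k'(θ) |∇θ|²` over `G`, and `k → ∞` gives the
  -- integral over `G`.
  let φ : ℕ → ℝ → ℝ := fun k y => Real.smoothTransition (k * y - 1)
  have hφs : ∀ k, ContDiff ℝ 1 (φ k) := fun k =>
    Real.smoothTransition.contDiff.comp ((contDiff_const.mul contDiff_id).sub contDiff_const)
  have hφm : ∀ k, Monotone (φ k) := fun k y z hyz =>
    Real.smoothTransition.monotone (by gcongr)
  have hφ0 : ∀ (k : ℕ) (y : ℝ), (k : ℝ) * y ≤ 1 → φ k y = 0 := fun k y hy =>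
    Real.smoothTransition.zero_of_nonpos (by linarith)
  have hnear : ∀ x ∈ G, q =ᶠ[𝓝 x] θ := fun x hx => by
    filter_upwards [hGo.mem_nhds hx] with y hy using (h y hy).symm
  have hvan : ∀ k, ∀ x ∉ G, ∀ᶠ y in 𝓝 x, φ k (q y) = 0 := by
    intro k x hx
    have h1 : Continuous fun y => (k : ℝ) * q y := continuous_const.mul hq
    have h2 : (k : ℝ) * q x < 1 := by rw [hGq hx]; simp
    filter_upwards [h1.continuousAt.eventually (gt_mem_nhds h2)] with y hy using hφ0 k _ hy.le
  have hgs : ∀ k, ContDiff ℝ 1 fun x => φ k (q x) := by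
    intro k
    rw [contDiff_iff_contDiffAt]
    intro x
    by_cases hx : x ∈ G
    · refine (((hφs k).comp (hθ.of_le (by norm_num))).contDiffAt (x := x)).congr_of_eventuallyEq ?_
      filter_upwards [hnear x hx] with y hy
      simp [hy]
    · exact contDiffAt_const.congr_of_eventuallyEq (hvan k x hx)
  have hgc : ∀ k, HasCompactSupport fun x => φ k (q x) := fun k =>
    hqc.comp_left (g := φ k) (hφ0 k 0 (by simp))
  have hneg : ∀ k, ∫ x, φ k (q x) * Laplacian.laplacian θ x ≤ 0 := by
    intro k
    rw [integral_mul_laplacian hθ (hgs k) (hgc k), neg_nonpos]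
    refine Finset.sum_nonneg fun j _ => integral_nonneg fun x => ?_
    by_cases hx : x ∈ G
    · have h1 : (fun y => φ k (q y)) =ᶠ[𝓝 x] fun y => φ k (θ y) := by
        filter_upwards [hnear x hx] with y hy
        rw [hy]
      have h2 := (((hφs k).differentiable one_ne_zero (θ x)).hasDerivAt.comp_hasFDerivAt x
        (hθ.differentiable two_ne_zero x).hasFDerivAt).fderiv
      have h3 : pderiv j (fun y => φ k (q y)) x = deriv (φ k) (θ x) * pderiv j θ x := by
        rw [pderiv_congr h1, pderiv]
        erw [h2]
        simp [pderiv]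
      rw [h3, mul_assoc]
      exact mul_nonneg ((hφm k).deriv_nonneg) (mul_self_nonneg _)
    · simp [pderiv_eq_zero_of_eventually (hvan k x hx) j]
  have hint : Integrable (G.indicator fun x => ‖Laplacian.laplacian θ x‖) := by
    rw [integrable_indicator_iff hGo.measurableSet]
    refine ((continuous_laplacian hθ).norm.continuousOn.integrableOn_compact hqc).mono_set ?_
    exact fun x hx => subset_tsupport q (ne_of_gt hx)
  have hlim := tendsto_integral_of_dominated_convergence
    (F := fun k x => φ k (q x) * Laplacian.laplacian θ x)
    (f := G.indicator fun x => Laplacian.laplacian θ x) (μ := volume) _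
    (fun k => ((hgs k).continuous.mul (continuous_laplacian hθ)).aestronglyMeasurable) hint
    (fun k => Eventually.of_forall fun x => ?_) (Eventually.of_forall fun x => ?_)
  · rw [integral_indicator hGo.measurableSet] at hlim
    exact le_of_tendsto' hlim hneg
  · by_cases hx : x ∈ G
    · rw [indicator_of_mem hx, norm_mul]
      refine mul_le_of_le_one_left (norm_nonneg _) ?_
      rw [Real.norm_of_nonneg (Real.smoothTransition.nonneg _)]
      exact Real.smoothTransition.le_one _
    · rw [indicator_of_notMem hx, (hvan k x hx).self_of_nhds]
      simp
  · by_cases hx : x ∈ G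
    · rw [indicator_of_mem hx]
      refine tendsto_const_nhds.congr' ?_
      have h1 : Tendsto (fun k : ℕ => (k : ℝ) * q x) atTop atTop :=
        tendsto_natCast_atTop_atTop.atTop_mul_const hx
      filter_upwards [h1.eventually_ge_atTop 2] with k hk
      rw [show φ k (q x) = 1 from Real.smoothTransition.one_of_one_le (by linarith), one_mul]
    · rw [indicator_of_notMem hx]
      refine tendsto_const_nhds.congr fun k => ?_
      rw [(hvan k x hx).self_of_nhds, zero_mul]

end Integration

/-! ### Rest in the exterior vacuum -/

section Solution

variable {n : ℕ} {R γ μ lam K T : ℝ} {ρ : ℝ → Space n → ℝ} {u : ℝ → Space n → Space n}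
  {s θ : ℝ → Space n → ℝ}

/-- The temperature of the gas, extended by zero to the vacuum, is continuous. -/
theorem IsClassicalSolution.exists_temperature_extension
    (h : IsClassicalSolution R γ μ lam K T ρ u s θ) (hR : 0 < R) (hγ : 1 < γ) {t : ℝ}
    (ht : t ∈ Icc 0 T) : ∃ q : Space n → ℝ, Continuous q ∧ (∀ x, 0 ≤ q x) ∧
      (∀ x, 0 < q x ↔ ρ t x ≠ 0) ∧ ∀ x, 0 < q x → θ t x = q x := by
  have hρ0 := h.density_nonneg t ht
  have hiff : ∀ x, 0 < Real.exp (s t x / specificHeat R γ) * ρ t x ^ (γ - 1) / R ↔ ρ t x ≠ 0 := by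
    intro x
    constructor
    · rintro h1 h2
      rw [h2, Real.zero_rpow (by linarith)] at h1
      simp at h1
    · intro h1
      have := (hρ0 x).lt_of_ne' h1
      positivity
  refine ⟨fun x => Real.exp (s t x / specificHeat R γ) * ρ t x ^ (γ - 1) / R, ?_, fun x => ?_,
    hiff, fun x hx => ?_⟩
  · have h1 := (contDiff_slice h.contDiff_entropy ht).continuous
    have h2 := (contDiff_slice h.contDiff_density ht).continuous
    have h3 : Continuous fun x => ρ t x ^ (γ - 1) :=
      h2.rpow_const fun x => Or.inr (by linarith)
    fun_prop
  · have := hρ0 x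
    positivity
  · have hpos := (hρ0 x).lt_of_ne' ((hiff x).1 hx)
    have h1 := h.state t ht x
    have h2 : ρ t x ^ γ = ρ t x * ρ t x ^ (γ - 1) := by
      rw [Real.rpow_sub_one hpos.ne']
      field_simp
    rw [pressure, h2] at h1
    rw [eq_div_iff hR.ne']
    refine mul_left_cancel₀ hpos.ne' ?_
    linear_combination h1

/-- For `K > 0`, the Laplacian of the temperature has nonpositive integral over the gas and equals
`-dissipation / K` in vacuum. Dissipation near `x₀` would thus keep the integral against large
cutoffs below a negative constant, contrary to the absence of flux through infinity. -/
theorem IsClassicalSolution.dissipation_eq_zero_of_norm_gt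
    (h : IsClassicalSolution R γ μ lam K T ρ u s θ) (hn : 1 ≤ n) (hR : 0 < R) (hγ : 1 < γ)
    (hμ : 0 < μ) (hlam : 0 < 2 * μ + n * lam) (hK : 0 ≤ K)
    (hdecay : K ≠ 0 → TemperatureGradientDecay T θ) {t : ℝ} (ht : t ∈ Ioo 0 T) {r : ℝ}
    (hvac : ∀ x, r < ‖x‖ → ρ t x = 0) {x₀ : Space n} (hx₀ : r < ‖x₀‖) :
    dissipation μ lam (u t) x₀ = 0 := by
  have hbal := fun x hx => h.dissipation_add_laplacian_eq_zero hγ ht (x := x) hx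
  rcases hK.eq_or_lt with rfl | hK
  · simpa using hbal x₀ (hvac x₀ hx₀)
  have ht' := Ioo_subset_Icc_self ht
  have hθ : ContDiff ℝ 2 (θ t) := h.contDiff_two_temperature hK.ne' t ⟨ht.1, ht.2.le⟩
  have hD0 := dissipation_nonneg hμ hlam (u t)
  have hDc : Continuous (dissipation μ lam (u t)) :=
    continuous_dissipation (h.contDiff_two_velocity t ht') μ lam
  by_contra hne
  obtain ⟨q, hqc, hq0, hqρ, hqθ⟩ := h.exists_temperature_extension hR hγ ht'
  have hqr : ∀ x, 0 < q x → ‖x‖ ≤ r := fun x hx => by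
    by_contra! h1
    exact (hqρ x).1 hx (hvac x h1)
  have hqs : HasCompactSupport q :=
    HasCompactSupport.of_support_subset_isCompact (isCompact_closedBall (0 : Space n) r)
      fun x hx => by
        rw [mem_closedBall_zero_iff]
        exact hqr x ((hq0 x).lt_of_ne' hx)
  have hneg := setIntegral_laplacian_nonpos hθ hqc hq0 hqs hqθ
  set G := {x | 0 < q x} with hG
  have hGo : IsOpen G := isOpen_lt continuous_const hqc
  have hδ : 0 < ‖x₀‖ - r := sub_pos.2 hx₀
  let b : ContDiffBump x₀ := ⟨(‖x₀‖ - r) / 2, ‖x₀‖ - r, by positivity, by linarith⟩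
  have hbx : b x₀ = 1 := b.one_of_mem_closedBall (by simp [b]; positivity)
  have hbs : ∀ x, b x ≠ 0 → r < ‖x‖ ∧ ‖x‖ ≤ 2 * ‖x₀‖ - r := by
    intro x hx
    have h1 : dist x x₀ < ‖x₀‖ - r := by
      by_contra! h1
      exact hx (b.zero_of_le_dist h1)
    rw [dist_eq_norm] at h1
    have h2 := norm_sub_norm_le x₀ x
    have h3 := norm_sub_norm_le x x₀
    rw [norm_sub_rev] at h2
    exact ⟨by linarith, by linarith⟩
  have hbDc : Continuous fun x => b x * dissipation μ lam (u t) x := b.continuous.mul hDc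
  have hbDs : HasCompactSupport fun x => b x * dissipation μ lam (u t) x :=
    b.hasCompactSupport.mul_right
  have hI : 0 < ∫ x, b x * dissipation μ lam (u t) x := by
    refine hbDc.integral_pos_of_hasCompactSupport_nonneg_nonzero (x := x₀) hbDs
      (fun x => mul_nonneg b.nonneg (hD0 x)) ?_
    rwa [hbx, one_mul]
  set I := ∫ x, b x * dissipation μ lam (u t) x with hIdef
  -- The radius `2 * ‖x₀‖ - r` makes `χ = 1` on the gas and on the support of `b`; the tolerance is
  -- half of the deficit `I / K`.
  obtain ⟨χ, hχ1, hχc, hχ0, hχa, hχI⟩ := exists_cutoff_integral_laplacian hn hθ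
    (hdecay hK.ne' t ⟨ht.1, ht.2.le⟩) (2 * ‖x₀‖ - r) (ε := I / K / 2) (by positivity)
  have hGint : Integrable (G.indicator fun x => Laplacian.laplacian (θ t) x) := by
    rw [integrable_indicator_iff hGo.measurableSet]
    exact ((continuous_laplacian hθ).continuousOn.integrableOn_compact hqs).mono_set
      fun x hx => subset_tsupport q (ne_of_gt hx)
  have hbInt : Integrable fun x => b x * dissipation μ lam (u t) x / K :=
    (hbDc.integrable_of_hasCompactSupport hbDs).div_const K
  -- Pointwise: on the gas `χ = 1` and `b = 0`; in vacuum `χ Δθ` is `-χ` times dissipation over `K`,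
  -- and `b ≤ χ`.
  have hle : ∫ x, χ x * Laplacian.laplacian (θ t) x
      ≤ ∫ x, (G.indicator (fun x => Laplacian.laplacian (θ t) x) x
        - b x * dissipation μ lam (u t) x / K) := by
    refine integral_mono ((hχ1.continuous.mul
      (continuous_laplacian hθ)).integrable_of_hasCompactSupport hχc.mul_right)
      (hGint.sub hbInt) fun x => ?_
    by_cases hx : x ∈ G
    · have h1 := hqr x hx
      have h2 : b x = 0 := by
        by_contra h2
        linarith [(hbs x h2).1]
      simp only [indicator_of_mem hx]
      rw [h2, hχa x (by linarith)]
      simp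
    · simp only [indicator_of_notMem hx]
      have h1 : ρ t x = 0 := by
        by_contra h1
        exact hx ((hqρ x).2 h1)
      have h2 : Laplacian.laplacian (θ t) x = -(dissipation μ lam (u t) x / K) := by
        rw [eq_neg_iff_add_eq_zero, add_div' _ _ _ hK.ne']
        rw [div_eq_zero_iff]
        left
        linarith [hbal x h1]
      have h3 : b x ≤ χ x := by
        by_cases hb : b x = 0
        · rw [hb]; exact hχ0 x
        · rw [hχa x (hbs x hb).2]; exact b.le_one
      have h4 : 0 ≤ dissipation μ lam (u t) x / K := div_nonneg (hD0 x) hK.le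
      rw [h2, mul_div_assoc]
      have := mul_le_mul_of_nonneg_right h3 h4
      linarith
  rw [integral_sub hGint hbInt, integral_indicator hGo.measurableSet, integral_div, ← hIdef] at hle
  have h5 := (abs_le.1 hχI).1
  have h6 : 0 < I / K := by positivity
  linarith

/-- In an exterior domain of vacuum the gas is at rest. -/
theorem IsClassicalSolution.velocity_eq_zero_of_norm_gt
    (h : IsClassicalSolution R γ μ lam K T ρ u s θ) (hn : 1 ≤ n) (hR : 0 < R) (hγ : 1 < γ)
    (hμ : 0 < μ) (hlam : 0 < 2 * μ + n * lam) (hK : 0 ≤ K)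
    (hdecay : K ≠ 0 → TemperatureGradientDecay T θ) {t : ℝ} (ht : t ∈ Ioo 0 T) {A r : ℝ}
    (hA : ∀ i x, |u t x i| ≤ A) (hu2 : ∀ i, MemLp (fun x => u t x i) 2) (hr : 0 ≤ r)
    (hvac : ∀ x, r < ‖x‖ → ρ t x = 0) {x : Space n} (hx : r < ‖x‖) : u t x = 0 :=
  eq_zero_of_symm_gradient_eq_zero (h.contDiff_two_velocity t (Ioo_subset_Icc_self ht)) hA hu2 hr
    (fun _ hy i j => symm_gradient_eq_zero hμ hlam
      (h.dissipation_eq_zero_of_norm_gt hn hR hγ hμ hlam hK hdecay ht hvac hy) i j) hx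

end Solution

end CNS

/-! ### Conservation laws and the virial identity -/

namespace CNS

section Integration

variable {n : ℕ} {T r : ℝ} {f : ℝ → Space n → ℝ}

theorem hasCompactSupport_of_norm_gt {E : Type*} [Zero E] {g : Space n → E}
    (hg : ∀ x, r < ‖x‖ → g x = 0) : HasCompactSupport g :=
  HasCompactSupport.of_support_subset_isCompact (isCompact_closedBall (0 : Space n) r)
    fun x hx => by
      rw [mem_closedBall_zero_iff]
      by_contra! h
      exact hx (hg x h)

theorem continuousOn_integral_slice
    (hf : ContDiffOn ℝ 1 (fun q : ℝ × Space n => f q.1 q.2) (Icc 0 T ×ˢ univ))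
    (hr : ∀ t ∈ Icc 0 T, ∀ x, r < ‖x‖ → f t x = 0) :
    ContinuousOn (fun t => ∫ x, f t x) (Icc 0 T) :=
  continuousOn_integral_of_compact_support (isCompact_closedBall (0 : Space n) r) hf.continuousOn
    fun t x ht hx => hr t ht x (by rwa [mem_closedBall_zero_iff, not_le] at hx)

/-- Differentiation under the integral sign for compactly supported `C¹` functions. -/
theorem hasDerivAt_integral_slice
    (hf : ContDiffOn ℝ 1 (fun q : ℝ × Space n => f q.1 q.2) (Icc 0 T ×ˢ univ))
    (hr : ∀ t ∈ Icc 0 T, ∀ x, r < ‖x‖ → f t x = 0) {t : ℝ} (ht : t ∈ Ioo 0 T) :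
    HasDerivAt (fun t => ∫ x, f t x) (∫ x, deriv (fun τ => f τ x) t) t := by
  have hnhds : Icc 0 T ∈ 𝓝 t := Icc_mem_nhds ht.1 ht.2
  obtain ⟨L, hL⟩ := exists_lipschitz_closedBall hf (0 : Space n) r
  set B := Metric.closedBall (0 : Space n) r with hB
  have hBr : ∀ x, x ∉ B → r < ‖x‖ := fun x hx => by rwa [mem_closedBall_zero_iff, not_le] at hx
  have hBfin : volume B ≠ ⊤ := measure_closedBall_lt_top.ne
  have hcont : ∀ τ ∈ Icc 0 T, Continuous (f τ) := fun τ hτ => (contDiff_slice hf hτ).continuous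
  have hder : (fun x => deriv (fun τ => f τ x) t)
      = fun x => fderiv ℝ (fun q : ℝ × Space n => f q.1 q.2) (t, x) (1, 0) :=
    funext fun x => (hasDerivAt_slice hf ht x).deriv
  have hmeas : Continuous fun x => deriv (fun τ => f τ x) t := by
    rw [hder, continuous_iff_continuousAt]
    intro x
    have h1 := ((contDiffAt_uncurry hf ht x).fderiv_right (m := 0) (by norm_num)).continuousAt
    exact (h1.comp (f := fun x : Space n => (t, x)) (by fun_prop)).clm_apply continuousAt_const
  have hmain := (hasDerivAt_integral_of_dominated_loc_of_lip (μ := volume.restrict B)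
    (F := f) (F' := fun x => deriv (fun τ => f τ x) t) (bound := fun _ => (L : ℝ)) hnhds
    (by filter_upwards [hnhds] with τ hτ using (hcont τ hτ).aestronglyMeasurable)
    ((hcont t (Ioo_subset_Icc_self ht)).continuousOn.integrableOn_compact
      (isCompact_closedBall _ _)) hmeas.aestronglyMeasurable
    (by
      filter_upwards [ae_restrict_mem measurableSet_closedBall] with x hx
      refine LipschitzOnWith.of_dist_le_mul fun a ha b hb => ?_
      simpa [Prod.dist_eq] using hL.dist_le_mul (a, x) ⟨ha, hx⟩ (b, x) ⟨hb, hx⟩)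
    (integrableOn_const hBfin)
    (Eventually.of_forall fun x => (hasDerivAt_slice hf ht x).differentiableAt.hasDerivAt)).2
  have h1 : ∫ x in B, deriv (fun τ => f τ x) t = ∫ x, deriv (fun τ => f τ x) t := by
    refine setIntegral_eq_integral_of_forall_compl_eq_zero fun x hx => ?_
    rw [Filter.EventuallyEq.deriv_eq (f := fun _ => (0 : ℝ))]
    · simp
    · filter_upwards [hnhds] with τ hτ using hr τ hτ x (hBr x hx)
  rw [h1] at hmain
  refine hmain.congr_of_eventuallyEq ?_
  filter_upwards [hnhds] with τ hτ
  exact (setIntegral_eq_integral_of_forall_compl_eq_zero fun x hx => hr τ hτ x (hBr x hx)).symm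

theorem integral_divergence_eq_zero {v : Space n → Space n} (hv : ContDiff ℝ 1 v)
    (hvc : HasCompactSupport v) : ∫ x, divergence v x = 0 := by
  have hc : ∀ j, HasCompactSupport fun x => v x j := fun j =>
    hvc.comp_left (g := fun y : Space n => y j) rfl
  unfold divergence
  rw [integral_finsetSum _ fun j _ => ?_]
  · exact Finset.sum_eq_zero fun j _ => integral_pderiv_eq_zero (contDiff_coord hv j) (hc j) j
  · exact (continuous_pderiv (contDiff_coord hv j) j).integrable_of_hasCompactSupport
      (hasCompactSupport_pderiv (hc j) j)

/-- This is why only traces of the momentum flux, pressure and stress survive in the virial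
identity. -/
theorem integral_coord_mul_pderiv {g : Space n → ℝ} (hg : ContDiff ℝ 1 g)
    (hgc : HasCompactSupport g) (i j : Fin n) :
    ∫ x, x i * pderiv j g x = -if i = j then ∫ x, g x else 0 := by
  have h := integral_mul_pderiv (contDiff_coord contDiff_id i) hg hgc j
  simp only [id, pderiv_coordinate] at h
  simp only [mul_comm _ (pderiv j g _)]
  rw [← neg_eq_iff_eq_neg.2 h]
  split_ifs <;> simp

theorem integrable_coord_mul_pderiv {g : Space n → ℝ} (hg : ContDiff ℝ 1 g)
    (hgc : HasCompactSupport g) (i j : Fin n) : Integrable fun x => x i * pderiv j g x :=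
  ((contDiff_coord (k := 0) contDiff_id i).continuous.mul
    (continuous_pderiv hg j)).integrable_of_hasCompactSupport
      (hasCompactSupport_pderiv hgc j).mul_left

/-- Cutoffs equal to one on the ball that carries the Laplacian do not change its integral, and they
make it arbitrarily small. The function `θ` itself need not have compact support. -/
theorem integral_laplacian_eq_zero (hn : 1 ≤ n) {θ : Space n → ℝ} (hθ : ContDiff ℝ 2 θ)
    (hdecay : (fun x => gradient θ x) =o[cocompact (Space n)] fun x => 1 / ‖x‖ ^ (n - 1))
    (h : ∀ x, r < ‖x‖ → Laplacian.laplacian θ x = 0) : ∫ x, Laplacian.laplacian θ x = 0 := by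
  refine abs_eq_zero.1 (le_antisymm (le_of_forall_pos_le_add fun ε hε => ?_) (abs_nonneg _))
  obtain ⟨χ, -, -, -, hχ, hI⟩ := exists_cutoff_integral_laplacian hn hθ hdecay r hε
  rw [zero_add]
  have e : (fun x => χ x * Laplacian.laplacian θ x) = fun x => Laplacian.laplacian θ x := by
    ext x
    rcases lt_or_ge r ‖x‖ with hx | hx
    · rw [h x hx, mul_zero]
    · rw [hχ x hx, one_mul]
  rwa [e] at hI

end Integration

section Solution

variable {n : ℕ} {R γ μ lam K T r : ℝ} {ρ : ℝ → Space n → ℝ} {u : ℝ → Space n → Space n}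
  {s θ : ℝ → Space n → ℝ}

theorem contDiffOn_velocity_coord
    (hu : ContDiffOn ℝ 1 (fun q : ℝ × Space n => u q.1 q.2) (Icc 0 T ×ˢ univ)) (i : Fin n) :
    ContDiffOn ℝ 1 (fun q : ℝ × Space n => u q.1 q.2 i) (Icc 0 T ×ˢ univ) :=
  (EuclideanSpace.proj (𝕜 := ℝ) i).contDiff.comp_contDiffOn hu

/-- A functional that is continuous on `[0, T]` with vanishing derivative in `(0, T)` is conserved. -/
theorem eq_initial_of_hasDerivAt_zero {g : ℝ → ℝ} (hc : ContinuousOn g (Icc 0 T))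
    (hd : ∀ t ∈ Ioo 0 T, HasDerivAt g 0 t) {t : ℝ} (ht : t ∈ Icc 0 T) : g t = g 0 := by
  have h := eq_zero_of_abs_deriv_le (a := 0) (b := t) (A := 0) (y := fun τ => g τ - g 0)
    (y' := fun _ => 0) ((hc.mono (Icc_subset_Icc_right ht.2)).sub continuousOn_const)
    (fun τ hτ => (hd τ ⟨hτ.1, hτ.2.trans_le ht.2⟩).sub_const _) (by simp) (sub_self _) ht.1
  exact sub_eq_zero.1 h

theorem IsClassicalSolution.integral_density_eq (h : IsClassicalSolution R γ μ lam K T ρ u s θ)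
    (hr : ∀ t ∈ Icc 0 T, ∀ x, r < ‖x‖ → ρ t x = 0) {t : ℝ} (ht : t ∈ Icc 0 T) :
    ∫ x, ρ t x = ∫ x, ρ 0 x := by
  refine eq_initial_of_hasDerivAt_zero (continuousOn_integral_slice h.contDiff_density hr)
    (fun t ht => ?_) ht
  have ht' := Ioo_subset_Icc_self ht
  refine (hasDerivAt_integral_slice h.contDiff_density hr ht).congr_deriv ?_
  have h1 : ∀ x, deriv (fun τ => ρ τ x) t = -divergence (fun y => ρ t y • u t y) x := fun x =>
    eq_neg_of_add_eq_zero_left (h.mass t ht x)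
  simp only [h1]
  rw [integral_neg, integral_divergence_eq_zero, neg_zero]
  · exact (contDiff_slice h.contDiff_density ht').smul (contDiff_slice h.contDiff_velocity ht')
  · exact hasCompactSupport_of_norm_gt fun x hx => by rw [hr t ht' x hx, zero_smul]

/-- The fluxes contain `u` as a factor, hence have compact support. Where `u` is at rest in vacuum
the dissipation is zero, so `K Δθ` vanishes outside the ball too and has integral zero. -/
theorem IsClassicalSolution.integral_energyDensity_eq
    (h : IsClassicalSolution R γ μ lam K T ρ u s θ) (hn : 1 ≤ n) (hγ : 1 < γ)
    (hdecay : K ≠ 0 → TemperatureGradientDecay T θ)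
    (hr : ∀ t ∈ Icc 0 T, ∀ x, r < ‖x‖ → ρ t x = 0)
    (hu : ∀ t ∈ Ioo 0 T, ∀ x, r < ‖x‖ → u t x = 0) {t : ℝ} (ht : t ∈ Icc 0 T) :
    ∫ x, energyDensity R γ ρ u θ t x = ∫ x, energyDensity R γ ρ u θ 0 x := by
  have hEr : ∀ t ∈ Icc 0 T, ∀ x, r < ‖x‖ → energyDensity R γ ρ u θ t x = 0 :=
    fun t ht x hx => energyDensity_eq_zero (hr t ht x hx)
  have hE := h.contDiffOn_energyDensity hγ
  refine eq_initial_of_hasDerivAt_zero (continuousOn_integral_slice hE hEr) (fun t ht => ?_) ht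
  have ht' := Ioo_subset_Icc_self ht
  refine (hasDerivAt_integral_slice hE hEr ht).congr_deriv ?_
  have hu1 := contDiff_slice h.contDiff_velocity ht'
  have hu2 := h.contDiff_two_velocity t ht'
  set v : Space n → Space n := fun y =>
    (energyDensity R γ ρ u θ t y + pressure R ρ θ t y) • u t y with hv
  set w : Fin n → Space n → ℝ := fun j y => ∑ i, u t y i * stress μ lam (u t) i j y with hw
  have hvd : ContDiff ℝ 1 v :=
    ((contDiff_slice hE ht').add (contDiff_slice (h.contDiffOn_pressure hγ) ht')).smul hu1
  have hvc : HasCompactSupport v := hasCompactSupport_of_norm_gt (r := r) fun x hx => by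
    simp only [hv]
    rw [hu t ht x hx, smul_zero]
  have hwd : ∀ j, ContDiff ℝ 1 (w j) := fun j => ContDiff.sum fun i _ =>
    (contDiff_coord hu1 i).mul (contDiff_stress hu2 μ lam i j)
  have hwc : ∀ j, HasCompactSupport (w j) := fun j =>
    hasCompactSupport_of_norm_gt (r := r) fun x hx => by
      simp only [hw]
      rw [hu t ht x hx]
      simp
  have hdivI : Integrable (divergence v) := by
    refine integrable_finsetSum _ fun j _ => ?_
    exact (continuous_pderiv (contDiff_coord hvd j) j).integrable_of_hasCompactSupport
      (hasCompactSupport_pderiv (hvc.comp_left (g := fun y : Space n => y j) rfl) j)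
  have hwI : ∀ j, Integrable (pderiv j (w j)) := fun j =>
    (continuous_pderiv (hwd j) j).integrable_of_hasCompactSupport
      (hasCompactSupport_pderiv (hwc j) j)
  have hlap : Integrable (fun x => K * Laplacian.laplacian (θ t) x) ∧
      ∫ x, K * Laplacian.laplacian (θ t) x = 0 := by
    by_cases hK : K = 0
    · simp [hK]
    have hθ := h.contDiff_two_temperature hK t ⟨ht.1, ht.2.le⟩
    have hzero : ∀ x, r < ‖x‖ → Laplacian.laplacian (θ t) x = 0 := by
      intro x hx
      have h1 := h.dissipation_add_laplacian_eq_zero hγ ht (hr t ht' x hx)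
      have h2 : dissipation μ lam (u t) x = 0 := by
        refine Finset.sum_eq_zero fun j _ => Finset.sum_eq_zero fun i _ => ?_
        rw [pderiv_eq_zero_of_eventually, zero_mul]
        filter_upwards [continuous_norm.continuousAt.eventually (lt_mem_nhds hx)] with y hy
        rw [hu t ht y hy]
        rfl
      rw [h2, zero_add] at h1
      exact (mul_eq_zero.1 h1).resolve_left hK
    refine ⟨((continuous_laplacian hθ).integrable_of_hasCompactSupport
      (hasCompactSupport_of_norm_gt hzero)).const_mul K, ?_⟩
    rw [integral_const_mul, integral_laplacian_eq_zero hn hθ (hdecay hK t ⟨ht.1, ht.2.le⟩) hzero,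
      mul_zero]
  have h1 : ∀ x, deriv (fun τ => energyDensity R γ ρ u θ τ x) t
      = (∑ j, pderiv j (w j) x) + K * Laplacian.laplacian (θ t) x - divergence v x := fun x =>
    eq_sub_of_add_eq (h.energy t ht x)
  simp only [h1]
  have hwS : Integrable fun x => ∑ j, pderiv j (w j) x := integrable_finsetSum _ fun j _ => hwI j
  have hwK : Integrable fun x => ∑ j, pderiv j (w j) x + K * Laplacian.laplacian (θ t) x :=
    hwS.add hlap.1
  rw [integral_sub hwK hdivI, integral_add hwS hlap.1, hlap.2,
    integral_divergence_eq_zero hvd hvc, integral_finsetSum _ fun j _ => hwI j]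
  simp [integral_pderiv_eq_zero (hwd _) (hwc _)]

/-- The derivative of the radial momentum: the virial identity. -/
theorem IsClassicalSolution.hasDerivAt_radialMomentum
    (h : IsClassicalSolution R γ μ lam K T ρ u s θ) (hγ : 1 < γ)
    (hr : ∀ t ∈ Icc 0 T, ∀ x, r < ‖x‖ → ρ t x = 0)
    (hu : ∀ t ∈ Ioo 0 T, ∀ x, r < ‖x‖ → u t x = 0) {t : ℝ} (ht : t ∈ Ioo 0 T) :
    HasDerivAt (fun t => ∫ x : Space n, ∑ i, x i * (ρ t x * u t x i))
      (∫ x, (ρ t x * ‖u t x‖ ^ 2 + n * pressure R ρ θ t x)) t := by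
  have ht' := Ioo_subset_Icc_self ht
  have hcoord : ∀ i : Fin n, ContDiff ℝ 1 fun q : ℝ × Space n => q.2 i := fun i =>
    (EuclideanSpace.proj (𝕜 := ℝ) i).contDiff.comp contDiff_snd
  have hf : ContDiffOn ℝ 1 (fun q : ℝ × Space n =>
      (fun (t : ℝ) (x : Space n) => ∑ i, x i * (ρ t x * u t x i)) q.1 q.2) (Icc 0 T ×ˢ univ) :=
    ContDiffOn.sum fun i _ => (hcoord i).contDiffOn.mul
      (h.contDiff_density.mul (contDiffOn_velocity_coord h.contDiff_velocity i))
  have hfr : ∀ t ∈ Icc 0 T, ∀ x : Space n, r < ‖x‖ → ∑ i, x i * (ρ t x * u t x i) = 0 :=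
    fun t ht x hx => by simp [hr t ht x hx]
  refine (hasDerivAt_integral_slice hf hfr ht).congr_deriv ?_
  have hρ1 := contDiff_slice h.contDiff_density ht'
  have hu1 := fun i => contDiff_coord (contDiff_slice h.contDiff_velocity ht') i
  have hu2 := h.contDiff_two_velocity t ht'
  have hp1 := contDiff_slice (h.contDiffOn_pressure hγ) ht'
  have hpc : HasCompactSupport (pressure R ρ θ t) :=
    hasCompactSupport_of_norm_gt fun x hx => pressure_eq_zero (hr t ht' x hx)
  have hm1 : ∀ i j, ContDiff ℝ 1 fun y => ρ t y * u t y i * u t y j := fun i j =>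
    (hρ1.mul (hu1 i)).mul (hu1 j)
  have hmc : ∀ i j, HasCompactSupport fun y => ρ t y * u t y i * u t y j := fun i j =>
    hasCompactSupport_of_norm_gt fun x hx => by rw [hr t ht' x hx, zero_mul, zero_mul]
  have hs1 : ∀ i j, ContDiff ℝ 1 (stress μ lam (u t) i j) := fun i j =>
    contDiff_stress hu2 μ lam i j
  have huc : ∀ i, HasCompactSupport fun y => u t y i := fun i =>
    hasCompactSupport_of_norm_gt fun x hx => by rw [hu t ht x hx]; rfl
  have hpz : ∀ i j x, r < ‖x‖ → pderiv j (fun y => u t y i) x = 0 := fun i j x hx => by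
    refine pderiv_eq_zero_of_eventually ?_ j
    filter_upwards [continuous_norm.continuousAt.eventually (lt_mem_nhds hx)] with y hy
    rw [hu t ht y hy]
    rfl
  have hsc : ∀ i j, HasCompactSupport (stress μ lam (u t) i j) := fun i j =>
    hasCompactSupport_of_norm_gt (r := r) fun x hx => by
      simp [stress, divergence, hpz _ _ x hx]
  have hder : ∀ x : Space n, deriv (fun τ => ∑ i, x i * (ρ τ x * u τ x i)) t
      = ∑ i, (∑ j, x i * pderiv j (stress μ lam (u t) i j) x
        - ∑ j, x i * pderiv j (fun y => ρ t y * u t y i * u t y j) x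
        - x i * pderiv i (pressure R ρ θ t) x) := by
    intro x
    have hd : ∀ i, HasDerivAt (fun τ => ρ τ x * u τ x i)
        (deriv (fun τ => ρ τ x * u τ x i) t) t := fun i =>
      ((hasDerivAt_slice h.contDiff_density ht x).fun_mul (hasDerivAt_slice
        (f := fun t x => u t x i) (contDiffOn_velocity_coord h.contDiff_velocity i) ht
        x)).differentiableAt.hasDerivAt
    rw [(HasDerivAt.fun_sum fun i _ => (hd i).const_mul (x i)).deriv]
    refine Finset.sum_congr rfl fun i _ => ?_
    rw [← Finset.mul_sum, ← Finset.mul_sum, ← mul_sub, ← mul_sub, ← h.momentum t ht x i]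
    ring
  simp only [hder]
  have i1 := fun i j => integrable_coord_mul_pderiv (hs1 i j) (hsc i j) i j
  have i2 := fun i j => integrable_coord_mul_pderiv (hm1 i j) (hmc i j) i j
  have i3 := fun i => integrable_coord_mul_pderiv hp1 hpc i i
  have i4 := fun i j => (hm1 i j).continuous.integrable_of_hasCompactSupport (μ := volume) (hmc i j)
  have i5 := hp1.continuous.integrable_of_hasCompactSupport (μ := volume) hpc
  have i6 : ∀ i j, Integrable (stress μ lam (u t) i j) := fun i j =>
    (hs1 i j).continuous.integrable_of_hasCompactSupport (hsc i j)
  have i7 : ∀ i : Fin n, Integrable fun x : Space n =>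
      ∑ j, x i * pderiv j (stress μ lam (u t) i j) x
        - ∑ j, x i * pderiv j (fun y => ρ t y * u t y i * u t y j) x := fun i =>
    (integrable_finsetSum _ fun j _ => i1 i j).sub (integrable_finsetSum _ fun j _ => i2 i j)
  -- The trace of the stress is a combination of first derivatives of the compactly supported
  -- velocity, so viscosity does not contribute.
  have htr : ∑ i, ∫ x, stress μ lam (u t) i i x = 0 := by
    have hpi : ∀ i, ∫ x, pderiv i (fun y => u t y i) x = 0 := fun i =>
      integral_pderiv_eq_zero (hu1 i) (huc i) i
    have hpI : ∀ i, Integrable (pderiv i fun y => u t y i) := fun i =>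
      (continuous_pderiv (hu1 i) i).integrable_of_hasCompactSupport
        (hasCompactSupport_pderiv (huc i) i)
    refine Finset.sum_eq_zero fun i _ => ?_
    simp only [stress, if_true]
    have h2 : ∫ x, divergence (u t) x = 0 := by
      unfold divergence
      rw [integral_finsetSum _ fun j _ => hpI j]
      simp [hpi]
    have hdI : Integrable fun x => lam * divergence (u t) x :=
      (integrable_finsetSum _ fun j _ => hpI j).const_mul lam
    have hgI : Integrable fun x =>
        μ * (pderiv i (fun y => u t y i) x + pderiv i (fun y => u t y i) x) :=
      ((hpI i).add (hpI i)).const_mul μ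
    rw [integral_add hgI hdI, integral_const_mul,
      integral_const_mul, h2, integral_add (hpI i) (hpI i), hpi]
    simp
  have hterm : ∀ i, ∫ x, (∑ j, x i * pderiv j (stress μ lam (u t) i j) x
        - ∑ j, x i * pderiv j (fun y => ρ t y * u t y i * u t y j) x
        - x i * pderiv i (pressure R ρ θ t) x)
      = -(∫ x, stress μ lam (u t) i i x) + (∫ x, ρ t x * u t x i * u t x i)
        + ∫ x, pressure R ρ θ t x := by
    intro i
    rw [integral_sub (i7 i) (i3 i),
      integral_sub (integrable_finsetSum _ fun j _ => i1 i j)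
      (integrable_finsetSum _ fun j _ => i2 i j), integral_finsetSum _ fun j _ => i1 i j,
      integral_finsetSum _ fun j _ => i2 i j, integral_coord_mul_pderiv hp1 hpc]
    simp only [integral_coord_mul_pderiv (hs1 i _) (hsc i _),
      integral_coord_mul_pderiv (hm1 i _) (hmc i _), Finset.sum_neg_distrib]
    simp
  rw [integral_finsetSum _ fun i _ => ?_]
  · simp only [hterm, Finset.sum_add_distrib, Finset.sum_neg_distrib, htr]
    rw [integral_add ?_ (i5.const_mul _), integral_const_mul,
      ← integral_finsetSum _ fun i _ => i4 i i]
    · simp only [EuclideanSpace.norm_sq_eq, Finset.mul_sum, Real.norm_eq_abs, sq_abs]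
      simp
      refine integral_congr_ae (Eventually.of_forall fun x => ?_)
      exact Finset.sum_congr rfl fun i _ => by ring
    · refine (integrable_finsetSum Finset.univ fun i _ => i4 i i).congr
        (Eventually.of_forall fun x => ?_)
      simp only [EuclideanSpace.norm_sq_eq, Finset.mul_sum, Real.norm_eq_abs, sq_abs]
      exact Finset.sum_congr rfl fun i _ => by ring
  · exact (i7 i).sub (i3 i)

end Solution

end CNS

/-! ### Bound for the life span -/

namespace CNS

section Solution

variable {n : ℕ} {R γ μ lam K T r : ℝ} {ρ : ℝ → Space n → ℝ} {u : ℝ → Space n → Space n}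
  {s θ : ℝ → Space n → ℝ}

/-- The radial momentum is bounded by mass and energy. -/
theorem IsClassicalSolution.abs_radialMomentum_le
    (h : IsClassicalSolution R γ μ lam K T ρ u s θ) (hγ : 1 < γ) (hr0 : 0 ≤ r)
    (hr : ∀ t ∈ Icc 0 T, ∀ x, r < ‖x‖ → ρ t x = 0) {t : ℝ} (ht : t ∈ Icc 0 T) :
    |∫ x : Space n, ∑ i, x i * (ρ t x * u t x i)|
      ≤ r * ((∫ x, ρ t x) / 2 + ∫ x, energyDensity R γ ρ u θ t x) := by
  have i1 : Integrable (ρ t) := (contDiff_slice h.contDiff_density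
    ht).continuous.integrable_of_hasCompactSupport (hasCompactSupport_of_norm_gt (hr t ht))
  have i2 : Integrable (energyDensity R γ ρ u θ t) := (contDiff_slice
    (h.contDiffOn_energyDensity hγ) ht).continuous.integrable_of_hasCompactSupport
      (hasCompactSupport_of_norm_gt fun x hx => energyDensity_eq_zero (hr t ht x hx))
  rw [← integral_div, ← integral_add (i1.div_const 2) i2, ← integral_const_mul,
    ← Real.norm_eq_abs]
  refine norm_integral_le_of_norm_le (((i1.div_const 2).add i2).const_mul r)
    (Eventually.of_forall fun x => ?_)
  rcases lt_or_ge r ‖x‖ with hx | hx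
  · simp [hr t ht x hx, energyDensity_eq_zero (hr t ht x hx)]
  · have hρ := h.density_nonneg t ht x
    have hp : 0 ≤ pressure R ρ θ t x / (γ - 1) :=
      div_nonneg (h.pressure_nonneg ht x) (sub_nonneg.2 hγ.le)
    have e : ∑ i, x i * (ρ t x * u t x i) = ρ t x * ⟪x, u t x⟫_ℝ := by
      rw [PiLp.inner_apply, Finset.mul_sum]
      refine Finset.sum_congr rfl fun i _ => ?_
      simp
      ring
    rw [e, norm_mul, Real.norm_of_nonneg hρ]
    have h1 : ‖⟪x, u t x⟫_ℝ‖ ≤ r * ‖u t x‖ :=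
      (norm_inner_le_norm x (u t x)).trans (by gcongr)
    calc ρ t x * ‖⟪x, u t x⟫_ℝ‖ ≤ ρ t x * (r * ‖u t x‖) := by gcongr
      _ = r * (ρ t x * ‖u t x‖) := by ring
      _ ≤ r * (ρ t x / 2 + energyDensity R γ ρ u θ t x) := by
          gcongr
          rw [energyDensity_eq]
          -- This is `‖u‖ ≤ 1 / 2 + ‖u‖ ^ 2 / 2`, with the nonnegative internal energy discarded.
          nlinarith [mul_nonneg hρ (sq_nonneg (‖u t x‖ - 1))]

/-- The virial inequality bounds the life span of a solution whose gas stays in a fixed ball and is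
surrounded by a velocity field at rest. -/
theorem IsClassicalSolution.mul_energy_le
    (h : IsClassicalSolution R γ μ lam K T ρ u s θ) (hn : 1 ≤ n) (hγ : 1 < γ) (hT : 0 ≤ T)
    (hdecay : K ≠ 0 → TemperatureGradientDecay T θ) (hr0 : 0 ≤ r)
    (hr : ∀ t ∈ Icc 0 T, ∀ x, r < ‖x‖ → ρ t x = 0)
    (hu : ∀ t ∈ Ioo 0 T, ∀ x, r < ‖x‖ → u t x = 0) :
    min 2 (γ - 1) * (∫ x, energyDensity R γ ρ u θ 0 x) * T
      ≤ 2 * (r * ((∫ x, ρ 0 x) / 2 + ∫ x, energyDensity R γ ρ u θ 0 x)) := by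
  set F : ℝ → ℝ := fun t => ∫ x : Space n, ∑ i, x i * (ρ t x * u t x i) with hF
  have hcoord : ∀ i : Fin n, ContDiff ℝ 1 fun q : ℝ × Space n => q.2 i := fun i =>
    (EuclideanSpace.proj (𝕜 := ℝ) i).contDiff.comp contDiff_snd
  have hf : ContDiffOn ℝ 1 (fun q : ℝ × Space n =>
      (fun (t : ℝ) (x : Space n) => ∑ i, x i * (ρ t x * u t x i)) q.1 q.2) (Icc 0 T ×ˢ univ) :=
    ContDiffOn.sum fun i _ => (hcoord i).contDiffOn.mul
      (h.contDiff_density.mul (contDiffOn_velocity_coord h.contDiff_velocity i))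
  have hFc : ContinuousOn F (Icc 0 T) :=
    continuousOn_integral_slice (r := r) hf fun t ht x hx => by simp [hr t ht x hx]
  have hFd := fun t ht => h.hasDerivAt_radialMomentum hγ hr hu (t := t) ht
  -- The virial integrand contains twice the kinetic energy and, as `n ≥ 1`, at least `γ - 1` times
  -- the internal energy. Conservation of energy makes the lower bound independent of time.
  have hlow : ∀ t ∈ Ioo 0 T,
      min 2 (γ - 1) * (∫ x, energyDensity R γ ρ u θ 0 x) ≤ deriv F t := by
    intro t ht
    have ht' := Ioo_subset_Icc_self ht
    rw [(hFd t ht).deriv, ← h.integral_energyDensity_eq hn hγ hdecay hr hu ht',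
      ← integral_const_mul]
    have hρ1 := (contDiff_slice h.contDiff_density ht').continuous
    have hu1 := (contDiff_slice h.contDiff_velocity ht').continuous
    have hp1 := (contDiff_slice (h.contDiffOn_pressure hγ) ht').continuous
    have hE1 := (contDiff_slice (h.contDiffOn_energyDensity hγ) ht').continuous
    refine integral_mono ?_ ?_ fun x => ?_
    · exact (hE1.integrable_of_hasCompactSupport (hasCompactSupport_of_norm_gt
        fun x hx => energyDensity_eq_zero (hr t ht' x hx))).const_mul _
    · refine Continuous.integrable_of_hasCompactSupport (by fun_prop)
        (hasCompactSupport_of_norm_gt (r := r) fun x hx => ?_)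
      rw [pressure_eq_zero (hr t ht' x hx), hr t ht' x hx]
      simp
    · have hρ := h.density_nonneg t ht' x
      have hp := h.pressure_nonneg ht' x
      have hγ' : 0 < γ - 1 := sub_pos.2 hγ
      have hn' : (1 : ℝ) ≤ n := by exact_mod_cast hn
      simp only [energyDensity_eq, mul_add]
      refine add_le_add ?_ ?_
      · have h1 : 0 ≤ 1 / 2 * ρ t x * ‖u t x‖ ^ 2 := by positivity
        have := mul_le_mul_of_nonneg_right (min_le_left 2 (γ - 1)) h1
        linarith
      · have h1 : 0 ≤ pressure R ρ θ t x / (γ - 1) := by positivity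
        have h2 := mul_le_mul_of_nonneg_right (min_le_right 2 (γ - 1)) h1
        rw [mul_div_cancel₀ _ hγ'.ne'] at h2
        have h3 := mul_le_mul_of_nonneg_right hn' hp
        linarith
  -- Linear growth over `[0, T]` has to fit between minus and plus the bound for the radial
  -- momentum, hence the factor `2`.
  have hmvt := (convex_Icc 0 T).mul_sub_le_image_sub_of_le_deriv hFc
    (fun t ht => by
      rw [interior_Icc] at ht
      exact (hFd t ht).differentiableAt.differentiableWithinAt)
    (fun t ht => by
      rw [interior_Icc] at ht
      exact hlow t ht) 0 (left_mem_Icc.2 hT) T (right_mem_Icc.2 hT) hT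
  have h0 := h.abs_radialMomentum_le hγ hr0 hr (left_mem_Icc.2 hT)
  have h1 := h.abs_radialMomentum_le hγ hr0 hr (right_mem_Icc.2 hT)
  rw [h.integral_density_eq hr (right_mem_Icc.2 hT),
    h.integral_energyDensity_eq hn hγ hdecay hr hu (right_mem_Icc.2 hT)] at h1
  rw [sub_zero] at hmvt
  have h2 := (abs_le.1 h0).1
  have h3 := (abs_le.1 h1).2
  simp only [hF] at hmvt
  linarith

/-- Positive mass gives a point with `ρ > 0`, where the pressure `exp(s/c_ν) ρ^γ` is positive even
if the gas is at rest. -/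
theorem IsClassicalSolution.integral_energyDensity_pos
    (h : IsClassicalSolution R γ μ lam K T ρ u s θ) (hγ : 1 < γ) (hT : 0 ≤ T)
    (hr : ∀ x, r < ‖x‖ → ρ 0 x = 0) (hM : 0 < ∫ x, ρ 0 x) :
    0 < ∫ x, energyDensity R γ ρ u θ 0 x := by
  have ht : (0 : ℝ) ∈ Icc 0 T := left_mem_Icc.2 hT
  obtain ⟨x, hx⟩ : ∃ x, ρ 0 x ≠ 0 := by
    by_contra! h1
    simp [h1] at hM
  refine (contDiff_slice (h.contDiffOn_energyDensity hγ)
    ht).continuous.integral_pos_of_hasCompactSupport_nonneg_nonzero (x := x)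
    (hasCompactSupport_of_norm_gt fun x hx => energyDensity_eq_zero (hr x hx))
    (h.energyDensity_nonneg hγ ht) (ne_of_gt ?_)
  have hρ : 0 < ρ 0 x := (h.density_nonneg 0 ht x).lt_of_ne' hx
  have hγ' : 0 < γ - 1 := sub_pos.2 hγ
  rw [energyDensity_eq, h.state 0 ht x]
  positivity

end Solution

end CNS

theorem mainTheorem6 (n m : ℕ) (hn : 1 ≤ n) (hm : n / 2 + 2 < m)
    (R γ μ lam K : ℝ) (hR : 0 < R) (hγ : 1 < γ)
    (hμ : 0 < μ) (hlam : 0 < 2 * μ + n * lam) (hK : 0 ≤ K)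
    (ρ₀ : CNS.Space n → ℝ) (u₀ : CNS.Space n → CNS.Space n) (s₀ : CNS.Space n → ℝ)
    (hρ₀ : HasCompactSupport ρ₀) (hM : 0 < ∫ x, ρ₀ x) :
    ∃ Tstar : ℝ, 0 < Tstar ∧
      ∀ (T : ℝ) (ρ : ℝ → CNS.Space n → ℝ) (u : ℝ → CNS.Space n → CNS.Space n)
        (s θ : ℝ → CNS.Space n → ℝ),
        0 < T →
        CNS.IsClassicalSolution R γ μ lam K T ρ u s θ →
        CNS.IsC1Sobolev m T ρ →
        (∀ i : Fin n, CNS.IsC1Sobolev m T fun t x => u t x i) →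
        CNS.IsC1Sobolev m T s →
        (K ≠ 0 → CNS.TemperatureGradientDecay T θ) →
        ρ 0 = ρ₀ → u 0 = u₀ → s 0 = s₀ →
        T < Tstar := by
  obtain ⟨R₀, hR₀, hsupp⟩ : ∃ R₀ : ℝ, 0 ≤ R₀ ∧ ∀ x, R₀ < ‖x‖ → ρ₀ x = 0 := by
    obtain ⟨r, hr⟩ := hρ₀.isBounded.subset_closedBall (0 : CNS.Space n)
    refine ⟨max r 0, le_max_right _ _, fun x hx => ?_⟩
    by_contra h
    have h1 := hr (subset_tsupport ρ₀ h)
    rw [mem_closedBall_zero_iff] at h1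
    exact absurd hx (not_lt.2 (h1.trans (le_max_left _ _)))
  -- The initial energy written through `s₀` instead of the temperature, so that it depends on the
  -- data alone.
  set E₀ : ℝ := ∫ x, (1 / 2 * ρ₀ x * ‖u₀ x‖ ^ 2
    + Real.exp (s₀ x / CNS.specificHeat R γ) * ρ₀ x ^ γ / (γ - 1)) with hE₀
  -- The time is fixed before any solution is given, when `E₀ > 0` is not yet known; the maximum
  -- with `1` makes it positive regardless. The `+ 1` makes the final inequality strict.
  refine ⟨max 1 (2 * (R₀ * ((∫ x, ρ₀ x) / 2 + E₀)) / (min 2 (γ - 1) * E₀) + 1),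
    lt_of_lt_of_le one_pos (le_max_left _ _), ?_⟩
  rintro T ρ u s θ hT h - hu - hdecay rfl rfl rfl
  have h0 : (0 : ℝ) ∈ Icc 0 T := left_mem_Icc.2 hT.le
  have hE : ∫ x, CNS.energyDensity R γ ρ u θ 0 x = E₀ := by
    rw [hE₀]
    congr 1
    ext x
    rw [CNS.energyDensity_eq, h.state 0 h0 x]
  have hm' : n < 2 * m := by omega
  choose A hA using fun i => (hu i).exists_bound hm' fun t ht =>
    (CNS.contDiff_coord (CNS.contDiff_slice h.contDiff_velocity ht) i).continuous
  have hA' : ∀ t ∈ Icc 0 T, ∀ i x, |u t x i| ≤ ∑ i, |A i| := fun t ht i x =>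
    (hA i t ht x).trans ((le_abs_self _).trans
      (Finset.single_le_sum (f := fun i => |A i|) (fun _ _ => abs_nonneg _) (Finset.mem_univ i)))
  have hU : ∀ t ∈ Icc 0 T, ∀ x, ‖u t x‖ ≤ ∑ _i : Fin n, ∑ i, |A i| := by
    intro t ht x
    have h1 : u t x = ∑ i, u t x i • EuclideanSpace.basisFun (Fin n) ℝ i :=
      ((EuclideanSpace.basisFun (Fin n) ℝ).sum_repr (u t x)).symm
    rw [h1]
    refine (norm_sum_le _ _).trans (Finset.sum_le_sum fun i _ => ?_)
    rw [norm_smul, OrthonormalBasis.norm_eq_one, mul_one]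
    exact hA' t ht i x
  -- The radius `r` is arbitrary because the confinement argument needs it before the support is
  -- known to stay within `R₀`.
  have hrest : ∀ t ∈ Ioo 0 T, ∀ r, 0 ≤ r → (∀ x, r < ‖x‖ → ρ t x = 0) →
      ∀ x, r < ‖x‖ → u t x = 0 := fun t ht r hr hvac x hx =>
    h.velocity_eq_zero_of_norm_gt hn hR hγ hμ hlam hK hdecay ht (hA' t (Ioo_subset_Icc_self ht))
      (fun i => (hu i).memLp (Ioo_subset_Icc_self ht)) hr hvac hx
  have hball := CNS.density_eq_zero_of_norm_gt h.contDiff_density h.contDiff_velocity h.mass hU hR₀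
    hsupp hrest
  have hbound := h.mul_energy_le hn hγ hT.le hdecay hR₀ hball
    fun t ht => hrest t ht R₀ hR₀ (hball t (Ioo_subset_Icc_self ht))
  have hpos := h.integral_energyDensity_pos hγ hT.le hsupp hM
  rw [hE] at hbound hpos
  have hc : 0 < min 2 (γ - 1) * E₀ := mul_pos (lt_min two_pos (sub_pos.2 hγ)) hpos
  have h1 : T ≤ 2 * (R₀ * ((∫ x, ρ 0 x) / 2 + E₀)) / (min 2 (γ - 1) * E₀) := by
    rw [le_div_iff₀ hc]
    linarith
  exact lt_of_lt_of_le (by linarith) (le_max_right _ _)
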